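/- Let $\alpha,\eta,\theta,R$ be real $N\times N$ matrices with $\alpha^{T}=\alpha>0$, $\eta^{T}=\eta\ge 0$, $\theta^{T}=-\theta$, $R^{T}=R\ge 0$ and $N_R=\operatorname{rank}R>0$, and for $\beta\ge 0$ consider the gyroscopic-dissipative Lagrangian system $$\alpha\ddot Q+(2\theta+\beta R)\dot Q+\eta Q=0 .$$ Its system operator on $\mathbb{C}^{2N}=\mathbb{C}^N\oplus\mathbb{C}^N$ is $A(\beta)=\Omega-\mathrm{i}\beta B$, where $$\Omega=\begin{bmatrix}-2\mathrm{i}K_p\theta K_p^{T}&-\mathrm{i}\Phi^{T}\\ \mathrm{i}\Phi&0\end{bmatrix},\quad B=\begin{bmatrix}K_pRK_p^{T}&0\\0&0\end{bmatrix},\quad K_p=\sqrt{\alpha}^{\,-1},\ K_q=\sqrt{\eta},\ \Phi=K_qK_p^{T}.$$ The quality factor of $\zeta\in\mathbb{C}$ is $Q_\zeta=\frac12\frac{|\operatorname{Re}\zeta|}{-\operatorname{Im}\zeta}$, with $Q_\zeta=+\infty$ if $\operatorname{Im}\zeta=0\ne\operatorname{Re}\zeta$ and $Q_\zeta=0$ if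 $\zeta=0$. A function of $\beta$ is called analytic (has a pole) at $\beta=\infty$ if for all large $\beta$ it is given by a function of $z=\beta^{-1}$ that is analytic at (is meromorphic with a pole at) $z=0$. A family of modes consists of functions $\zeta_j(\beta)\in\mathbb{C}$, $w_j(\beta)\in\mathbb{C}^{2N}$, $1\le j\le 2N$, such that for all large $\beta$ one has $A(\beta)w_j(\beta)=\zeta_j(\beta)w_j(\beta)$ and $w_1(\beta),\dots,w_{2N}(\beta)$ is a basis of $\mathbb{C}^{2N}$, all $w_j$ are analytic at $\beta=\infty$, the $\zeta_j$ with $1\le j\le N_R$ (high-loss modes) have a pole at $\beta=\infty$, and the $\zeta_j$ with $N_R+1\le j\le 2N$ (low-loss modes) are analytic at $\beta=\infty$. Below, $f(\beta)\searrow 0$ means that $f(\beta)\to0$ as $\beta\to\infty$ and that, on some interval $[b,\infty)$, $f$ is either strictly decreasing or identically $0$; $f(\beta)\nearrow+\infty$ means that $f(\beta)\to+\infty$ as $\beta\to\infty$ and that, on some interval $[b,\infty)$, $f$ is either strictly increasing or identically $+\infty$. **Theorem (Quality factor-duality).** A family of modes exists, and for every family of modes the following holds. 1. $Q_{\zeta_j(\beta)}\searrow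 0$ for the high-loss modes, $1\le j\le N_R$. 2. If $\operatorname{Ker}R\cap\operatorname{Ker}\eta=\{0\}$, then the low-loss modes can be reindexed so that $\lim_{\beta\to\infty}\zeta_j(\beta)=0$ for $N_R+1\le j\le 2N_R$ and $\lim_{\beta\to\infty}\zeta_j(\beta)=\rho_j$ with $\rho_j\in\mathbb{R}\setminus\{0\}$ for $2N_R+1\le j\le 2N$; and whenever they are so indexed, $Q_{\zeta_j(\beta)}\searrow 0$ for $N_R+1\le j\le 2N_R$ (the $N_R$ low-loss/low-Q modes) and $Q_{\zeta_j(\beta)}\nearrow+\infty$ for $2N_R+1\le j\le 2N$ (the $2(N-N_R)$ low-loss/high-Q modes). -/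

import Mathlib

open Filter Topology Set
open scoped ENNReal MatrixOrder

/-- A gyroscopic-dissipative Lagrangian system `α Q'' + (2 θ + β R) Q' + η Q = 0` with `N` degrees
of freedom (the loss parameter `β ≥ 0` is kept as a variable): real `N × N` matrices with
`αᵀ = α > 0`, `ηᵀ = η ≥ 0`, `θᵀ = -θ`, `Rᵀ = R ≥ 0` and `rank R > 0`. -/
structure LagrangianSystem (N : ℕ) where
  α : Matrix (Fin N) (Fin N) ℝ
  η : Matrix (Fin N) (Fin N) ℝ
  θ : Matrix (Fin N) (Fin N) ℝ
  R : Matrix (Fin N) (Fin N) ℝ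
  α_posDef : α.PosDef
  η_posSemidef : η.PosSemidef
  θ_skew : θ.transpose = -θ
  R_posSemidef : R.PosSemidef
  rank_pos : 0 < R.rank

namespace LagrangianSystem

variable {N : ℕ} (S : LagrangianSystem N)

/-- `N_R = rank R`. -/
noncomputable def lossRank : ℕ := S.R.rank

/-- `K_p = (√α)⁻¹`. -/
noncomputable def Kp : Matrix (Fin N) (Fin N) ℝ := (CFC.sqrt S.α)⁻¹

/-- `K_q = √η`. -/
noncomputable def Kq : Matrix (Fin N) (Fin N) ℝ := CFC.sqrt S.η

/-- `Φ = K_q K_pᵀ`. -/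
noncomputable def Phi : Matrix (Fin N) (Fin N) ℝ := S.Kq * S.Kp.transpose

/-- The frequency operator `Ω = [[-2i K_p θ K_pᵀ, -i Φᵀ], [i Φ, 0]]` on `ℂ^{2N} = ℂ^N ⊕ ℂ^N`. -/
noncomputable def Omega : Matrix (Fin N ⊕ Fin N) (Fin N ⊕ Fin N) ℂ :=
  Matrix.fromBlocks
    ((-2 * Complex.I) • (S.Kp * S.θ * S.Kp.transpose).map Complex.ofReal)
    ((-Complex.I) • S.Phi.transpose.map Complex.ofReal)
    (Complex.I • S.Phi.map Complex.ofReal)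
    0

/-- The dissipation operator `B = [[K_p R K_pᵀ, 0], [0, 0]]`. -/
noncomputable def B : Matrix (Fin N ⊕ Fin N) (Fin N ⊕ Fin N) ℂ :=
  Matrix.fromBlocks ((S.Kp * S.R * S.Kp.transpose).map Complex.ofReal) 0 0 0

/-- The system operator `A(β) = Ω - i β B`. -/
noncomputable def A (β : ℝ) : Matrix (Fin N ⊕ Fin N) (Fin N ⊕ Fin N) ℂ :=
  S.Omega - (Complex.I * (β : ℂ)) • S.B

end LagrangianSystem

/-- `f` is analytic at `β = ∞`: for large `β` it is an analytic function of `z = β⁻¹` near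
`z = 0`. -/
def AnalyticAtInfinity {E : Type*} [NormedAddCommGroup E] [NormedSpace ℂ E] (f : ℝ → E) : Prop :=
  ∃ g : ℂ → E, AnalyticAt ℂ g 0 ∧ ∀ᶠ β : ℝ in atTop, f β = g ((β : ℂ)⁻¹)

/-- `f` has a pole at `β = ∞`: for large `β` it is a meromorphic function of `z = β⁻¹` near
`z = 0` with a pole at `z = 0`. -/
def HasPoleAtInfinity (f : ℝ → ℂ) : Prop :=
  ∃ g : ℂ → ℂ, MeromorphicAt g 0 ∧ meromorphicOrderAt g 0 < 0 ∧
    ∀ᶠ β : ℝ in atTop, f β = g ((β : ℂ)⁻¹)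

namespace LagrangianSystem

variable {N : ℕ} (S : LagrangianSystem N)

/-- The eigenpairs `ζ_j(β)`, `w_j(β)`, `1 ≤ j ≤ 2N` (here `j` runs from `0` to `2N - 1`), of the
high-loss regime. For large `β` the `w_j(β)` are a basis of `ℂ^{2N}` of eigenvectors of `A(β)`. The
eigenvectors are analytic at `β = ∞`, the first `N_R` eigenvalues (high-loss) have poles at
`β = ∞`, and the remaining `2N - N_R` ones (low-loss) are analytic at `β = ∞`. -/
structure IsModeFamily (ζ : Fin (2 * N) → ℝ → ℂ)
    (w : Fin (2 * N) → ℝ → (Fin N ⊕ Fin N → ℂ)) : Prop where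
  eigen : ∀ᶠ β : ℝ in atTop, ∀ j, (S.A β).mulVec (w j β) = ζ j β • w j β
  basis : ∀ᶠ β : ℝ in atTop, LinearIndependent ℂ (fun j => w j β)
  vec_analytic : ∀ j, AnalyticAtInfinity (w j)
  high_loss : ∀ j : Fin (2 * N), (j : ℕ) < S.lossRank → HasPoleAtInfinity (ζ j)
  low_loss : ∀ j : Fin (2 * N), S.lossRank ≤ (j : ℕ) → AnalyticAtInfinity (ζ j)

/-- The low-loss eigenvalues are indexed by their limits: `ζ_j → 0` for `N_R + 1 ≤ j ≤ 2 N_R` and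
`ζ_j → ρ_j ≠ 0` (`ρ_j` real) for `2 N_R + 1 ≤ j ≤ 2N` (shifted by one, as `j` starts at `0`). -/
def IsIndexedByLimits (ζ : Fin (2 * N) → ℝ → ℂ) : Prop :=
  (∀ j : Fin (2 * N), S.lossRank ≤ (j : ℕ) → (j : ℕ) < 2 * S.lossRank →
    Tendsto (ζ j) atTop (𝓝 0)) ∧
  (∀ j : Fin (2 * N), 2 * S.lossRank ≤ (j : ℕ) →
    ∃ ρ : ℝ, ρ ≠ 0 ∧ Tendsto (ζ j) atTop (𝓝 (ρ : ℂ)))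

end LagrangianSystem

/-- The quality factor `Q_ζ = |Re ζ| / (2 (-Im ζ))`, with `Q_ζ = +∞` if `Im ζ = 0`, `Re ζ ≠ 0`, and
`Q_ζ = 0` if `ζ = 0`. -/
noncomputable def qFactor (ζ : ℂ) : ℝ≥0∞ :=
  if ζ = 0 then 0
  else if ζ.im = 0 then ⊤
  else ENNReal.ofReal (1 / 2 * (|ζ.re| / -ζ.im))

/-- `f(β) ↘ 0` as `β → ∞`: `f` tends to `0` and, for large `β`, is strictly decreasing unless it is
already identically `0` (the overdamped modes). -/
def DecreasesToZero (f : ℝ → ℝ≥0∞) : Prop :=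
  (∃ b : ℝ, (∀ β ∈ Ici b, f β = 0) ∨ StrictAntiOn f (Ici b)) ∧ Tendsto f atTop (𝓝 0)

/-- `f(β) ↗ +∞` as `β → ∞`: `f` tends to `+∞` and, for large `β`, is strictly increasing unless it
is already identically `+∞` (the undamped modes). -/
def IncreasesToTop (f : ℝ → ℝ≥0∞) : Prop :=
  (∃ b : ℝ, (∀ β ∈ Ici b, f β = ⊤) ∨ StrictMonoOn f (Ici b)) ∧ Tendsto f atTop (𝓝 ⊤)

/-! Put `z = i/β`. Since `-iβ · (i/β) = 1`, one has `A(β) = -iβ (B + zΩ)`, so modes of `A(β)` are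
eigenpairs of the pencil `B + zΩ` on the imaginary axis. The pencil is self-adjoint for real `z`, so
Rellich's theorem gives an eigenbasis analytic in a complex neighbourhood of `0`, with eigenvalues
`l_j`. Then `ζ_j = -iβ l_j(i/β)` has a pole if `l_j(0) ≠ 0`, which happens for `rank B = N_R`
indices. Otherwise it tends to `l_j'(0)`, a real eigenvalue of the compression of `Ω` to `ker B`.
When `Ker R ∩ Ker η = 0`, the kernel of this compression is `{0} ⊕ Φ(ker K_p R K_pᵀ)^⊥`, of
dimension `N_R`; this counts the modes tending to zero. An arbitrary family has, with multiplicity,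
the same eigenvalues as the constructed one, hence the same number of limits `0`.

Limits of `Q`: pairing the eigenvalue equation with the eigenvector gives `Im ζ ≤ 0` and `|Re ζ| ≤
‖Ω‖`. So a pole forces `-Im ζ → ∞` and `Q → 0`, while a nonzero real limit forces `Q → ∞`. If `ζ →
0`, analyticity gives `ζ = O(1/β)`. For a unit eigenvector `(φ, ψ)` with `ζ ≠ 0` the block equations
give `φ = O(1/β)`, then `Re ζ = O(1/β²)` but `-Im ζ ≥ c/β` (`exists_overdamped_bound`), so `Q → 0`.

Monotonicity: as a function of `1/β`, `Q` is identically `0`, identically `+∞`, or a quotient of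
real analytic functions, whose derivative has a fixed sign to the right of `0`. So `Q` is eventually
constant or strictly monotone, and its limit decides which
(`qFactor_eventually_constant_or_strict`). -/

/-! ### Analytic block diagonalization by the implicit function theorem -/

section BlockDiagonalization

/-- The commutator with `T₀` of the off-diagonal part of `H` is off-diagonal, because `T₀` commutes
with `P`, while the right side of `hH` is block diagonal; so both vanish. The off-diagonal part then
commutes with `T₀`, hence with `P`, and is zero. This is injectivity of the linearized block
diagonalization equation. -/
theorem eq_zero_of_commutator_blocks {𝔸 : Type*} [Ring 𝔸] {P T₀ H : 𝔸} (hP : P * P = P) (hPT : P * T₀ = T₀ * P)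
    (hcomm : ∀ X : 𝔸, T₀ * X = X * T₀ → P * X = X * P)
    (hH : T₀ * (P * H * (1 - P) + (1 - P) * H * P) - (P * H * (1 - P) + (1 - P) * H * P) * T₀ =
      P * H * P + (1 - P) * H * (1 - P)) : H = 0 := by
  set Q : 𝔸 := 1 - P with hQ
  have hQP : Q * P = 0 := by rw [hQ, sub_mul, one_mul, hP, sub_self]
  have hPQ : P * Q = 0 := by rw [hQ, mul_sub, mul_one, hP, sub_self]
  have hQQ : Q * Q = Q := by nth_rewrite 2 [hQ]; rw [mul_sub, mul_one, hQP, sub_zero]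
  have hQT : Q * T₀ = T₀ * Q := by rw [hQ, sub_mul, mul_sub, hPT, one_mul, mul_one]
  have hsum : P + Q = 1 := by rw [hQ]; abel
  have r1 : ∀ x, P * (P * x) = P * x := fun x => by rw [← mul_assoc, hP]
  have r2 : ∀ x, Q * (P * x) = 0 := fun x => by rw [← mul_assoc, hQP, zero_mul]
  have r3 : ∀ x, P * (Q * x) = 0 := fun x => by rw [← mul_assoc, hPQ, zero_mul]
  have r4 : ∀ x, Q * (Q * x) = Q * x := fun x => by rw [← mul_assoc, hQQ]
  have r5 : ∀ x, P * (T₀ * x) = T₀ * (P * x) := fun x => by rw [← mul_assoc, hPT, mul_assoc]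
  have r6 : ∀ x, Q * (T₀ * x) = T₀ * (Q * x) := fun x => by rw [← mul_assoc, hQT, mul_assoc]
  have h1 : P * H * P = 0 := by
    have := congrArg (fun x => P * x * P) hH
    simp only [mul_sub, sub_mul, mul_add, add_mul, mul_assoc, r1, r2, r3, r5, hP, hQP,
      ← hPT, mul_zero, add_zero, sub_zero] at this
    rw [mul_assoc]; exact this.symm
  have h2 : Q * H * Q = 0 := by
    have := congrArg (fun x => Q * x * Q) hH
    simp only [mul_sub, sub_mul, mul_add, add_mul, mul_assoc, r2, r3, r4, r6, hPQ,
      hQQ, ← hQT, mul_zero, zero_add, sub_zero] at this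
    rw [mul_assoc]; exact this.symm
  rw [h1, h2, add_zero, sub_eq_zero] at hH
  have hc := hcomm _ hH
  have h3 : P * H * Q = 0 := by
    have := congrArg (fun x => x * Q) hc
    simpa only [mul_add, add_mul, mul_assoc, r1, r2, r3, r4, hP, hPQ, hQP, hQQ, mul_zero, add_zero,
      zero_add] using this
  have h4 : Q * H * P = 0 := by
    have := congrArg (fun x => Q * x) hc
    simpa only [mul_add, add_mul, mul_assoc, r1, r2, r3, r4, hP, hPQ, hQP, hQQ, mul_zero, add_zero,
      zero_add] using this.symm
  calc H = (P + Q) * H * (P + Q) := by rw [hsum, one_mul, mul_one]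
    _ = P * H * P + Q * H * Q + (P * H * Q + Q * H * P) := by noncomm_ring
    _ = 0 := by rw [h1, h2, h3, h4]; simp

/-- An analytic family whose value at `0` commutes with an idempotent `P` is analytically similar
to a family commuting with `P`, provided `P` commutes with the commutant of that value. -/
theorem exists_analytic_block_diagonalization {𝔸 : Type*} [NormedRing 𝔸]
    [NormedAlgebra ℂ 𝔸] [FiniteDimensional ℂ 𝔸] {P : 𝔸} {T : ℂ → 𝔸}
    (hT : AnalyticAt ℂ T 0) (hP : P * P = P) (hPT : P * T 0 = T 0 * P)
    (hcomm : ∀ X : 𝔸, T 0 * X = X * T 0 → P * X = X * P) :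
    ∃ U D : ℂ → 𝔸, AnalyticAt ℂ U 0 ∧ AnalyticAt ℂ D 0 ∧ U 0 = 1 ∧
      (∀ᶠ z in 𝓝 0, T z * U z = U z * D z) ∧ ∀ z, P * D z = D z * P := by
  have : CompleteSpace 𝔸 := FiniteDimensional.complete ℂ 𝔸
  let mulLR (a b : 𝔸) : 𝔸 →L[ℂ] 𝔸 :=
    (ContinuousLinearMap.mul ℂ 𝔸 a).comp ((ContinuousLinearMap.mul ℂ 𝔸).flip b)
  have hLR : ∀ a b x, mulLR a b x = a * x * b := fun a b x => by simp [mulLR, mul_assoc]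
  let off : 𝔸 →L[ℂ] 𝔸 := mulLR P (1 - P) + mulLR (1 - P) P
  let dia : 𝔸 →L[ℂ] 𝔸 := mulLR P P + mulLR (1 - P) (1 - P)
  have hoff : ∀ x, off x = P * x * (1 - P) + (1 - P) * x * P := fun x => by simp [off, hLR]
  have hdia : ∀ x, dia x = P * x * P + (1 - P) * x * (1 - P) := fun x => by simp [dia, hLR]
  have hPQ : P * (1 - P) = 0 := by rw [mul_sub, mul_one, hP, sub_self]
  have hQP : (1 - P) * P = 0 := by rw [sub_mul, one_mul, hP, sub_self]
  have hoff0 : off (T 0) = 0 := by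
    rw [hoff, hPT, mul_assoc, hPQ, mul_zero, mul_assoc, ← hPT, ← mul_assoc, hQP, zero_mul, add_zero]
  have hdia0 : dia (T 0) = T 0 := by
    rw [hdia]
    have : T 0 = P * T 0 * P + (1 - P) * T 0 * (1 - P) + off (T 0) := by
      rw [hoff]; noncomm_ring
    rw [hoff0, add_zero] at this
    exact this.symm
  have hdc : ∀ x, P * dia x = dia x * P := fun x => by
    rw [hdia, mul_add, add_mul]
    rw [show P * ((1 - P) * x * (1 - P)) = P * (1 - P) * x * (1 - P) by noncomm_ring, hPQ,
      mul_assoc ((1 - P) * x), hQP, mul_assoc (P * x), hP, ← mul_assoc, ← mul_assoc, hP]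
    simp
  -- One unknown `Y` carries both halves of the problem: its off-diagonal part corrects the
  -- similarity `U = 1 + off Y`, its diagonal part is the new family `D = dia Y`. At `z = 0` the
  -- solution is `Y = T 0`.
  let F : ℂ × 𝔸 → 𝔸 := fun p => T p.1 * (1 + off p.2) - (1 + off p.2) * dia p.2
  have hF : AnalyticAt ℂ F (0, T 0) := by
    have e1 : AnalyticAt ℂ (fun p : ℂ × 𝔸 => T p.1) (0, T 0) :=
      AnalyticAt.fun_comp (f := Prod.fst) hT analyticAt_fst
    have e2 : AnalyticAt ℂ (fun p : ℂ × 𝔸 => 1 + off p.2) (0, T 0) :=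
      analyticAt_const.add (off.analyticAt _ |>.fun_comp analyticAt_snd)
    have e3 : AnalyticAt ℂ (fun p : ℂ × 𝔸 => dia p.2) (0, T 0) :=
      (dia.analyticAt _ |>.fun_comp analyticAt_snd)
    exact (e1.mul e2).sub (e2.mul e3)
  have hF0 : F (0, T 0) = 0 := by simp [F, hoff0, hdia0]
  -- The partial derivative in `Y` at `T 0` is `H ↦ [T 0, off H] - dia H`; in finite dimension
  -- injectivity makes it invertible.
  let F' : 𝔸 →L[ℂ] 𝔸 :=
    (ContinuousLinearMap.mul ℂ 𝔸 (T 0)).comp off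
      - ((ContinuousLinearMap.mul ℂ 𝔸).flip (T 0)).comp off - dia
  have hF' : fderiv ℂ F (0, T 0) ∘L .inr ℂ ℂ 𝔸 = F' := by
    have d1 : HasFDerivAt (fun Y : 𝔸 => F (0, Y)) (fderiv ℂ F (0, T 0) ∘L .inr ℂ ℂ 𝔸) (T 0) :=
      HasFDerivAt.comp (T 0) hF.differentiableAt.hasFDerivAt (hasFDerivAt_prodMk_right 0 (T 0))
    have d2 : HasFDerivAt (fun Y : 𝔸 => F (0, Y)) F' (T 0) := by
      have o := (off.hasFDerivAt (x := T 0)).const_add (1 : 𝔸)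
      have := (HasFDerivAt.const_mul o (T 0)).sub (HasFDerivAt.mul' o (dia.hasFDerivAt (x := T 0)))
      refine this.congr_fderiv ?_
      ext x
      simp [F', hoff0, hdia0]
      abel
    exact d1.unique d2
  have hinj : Function.Injective F'.toLinearMap := by
    rw [← LinearMap.ker_eq_bot, LinearMap.ker_eq_bot']
    intro H hH
    refine eq_zero_of_commutator_blocks hP hPT hcomm ?_
    rw [← hoff, ← hdia, ← sub_eq_zero]
    simpa [F'] using hH
  have hinv : (fderiv ℂ F (0, T 0) ∘L .inr ℂ ℂ 𝔸).IsInvertible := by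
    rw [hF']
    exact ⟨(LinearEquiv.ofInjectiveEndo F'.toLinearMap hinj).toContinuousLinearEquiv, by
      ext x; rfl⟩
  -- Smoothness of order `⊤` means analyticity, and the implicit function inherits it.
  have cdf : ContDiffAt ℂ ⊤ F (0, T 0) := hF.contDiffAt
  let Y := cdf.implicitFunction (by simp) hinv
  have hY : AnalyticAt ℂ Y 0 := (cdf.contDiffAt_implicitFunction (by simp) hinv).analyticAt
  have hY0 : Y 0 = T 0 := cdf.implicitFunction_apply_self (by simp) hinv
  have hYF : ∀ᶠ z in 𝓝 0, F (z, Y z) = F (0, T 0) :=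
    cdf.eventually_apply_implicitFunction (by simp) hinv
  refine ⟨fun z => 1 + off (Y z), fun z => dia (Y z),
    analyticAt_const.add ((off.analyticAt _).fun_comp hY), (dia.analyticAt _).fun_comp hY, ?_, ?_,
    fun z => hdc _⟩
  · simp [hY0, hoff0]
  · filter_upwards [hYF] with z hz
    rw [hF0, sub_eq_zero] at hz
    exact hz

end BlockDiagonalization

/-! ### Rellich's theorem: analytic eigenbases of symmetric families -/

section AnalyticEigenbasis

theorem AnalyticAt.clm_apply {𝕜 E F G : Type*} [NontriviallyNormedField 𝕜]
    [NormedAddCommGroup E] [NormedSpace 𝕜 E] [NormedAddCommGroup F] [NormedSpace 𝕜 F]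
    [NormedAddCommGroup G] [NormedSpace 𝕜 G] {f : G → E →L[𝕜] F} {g : G → E} {x : G}
    (hf : AnalyticAt 𝕜 f x) (hg : AnalyticAt 𝕜 g x) : AnalyticAt 𝕜 (fun z => f z (g z)) x :=
  ((ContinuousLinearMap.id 𝕜 (E →L[𝕜] F)).analyticAt_bilinear (f x, g x)).comp₂ hf hg

theorem AnalyticAt.clm_comp {𝕜 E F G K : Type*} [NontriviallyNormedField 𝕜]
    [NormedAddCommGroup E] [NormedSpace 𝕜 E] [NormedAddCommGroup F] [NormedSpace 𝕜 F]
    [NormedAddCommGroup G] [NormedSpace 𝕜 G] [NormedAddCommGroup K] [NormedSpace 𝕜 K]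
    {f : K → F →L[𝕜] G} {g : K → E →L[𝕜] F} {x : K}
    (hf : AnalyticAt 𝕜 f x) (hg : AnalyticAt 𝕜 g x) : AnalyticAt 𝕜 (fun z => (f z).comp (g z)) x :=
  ((ContinuousLinearMap.compL 𝕜 E F G).analyticAt_bilinear (f x, g x)).comp₂ hf hg

variable {V : Type*} [NormedAddCommGroup V] [NormedSpace ℂ V] [FiniteDimensional ℂ V]
  {H : Type*} [NormedAddCommGroup H] [InnerProductSpace ℂ H]

/-- An analytic family of operators `T z` which, for real `z`, is symmetric for the sesquilinear
form pulled back from an inner product by an analytic family of embeddings `J z`. -/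
structure IsSymmetricFamily (T : ℂ → V →L[ℂ] V) (J : ℂ → V →L[ℂ] H) : Prop where
  analytic : AnalyticAt ℂ T 0
  analytic_embedding : AnalyticAt ℂ J 0
  injective : Function.Injective (J 0)
  symm : ∀ᶠ t : ℝ in 𝓝 0, ∀ u v, inner ℂ (J t (T t u)) (J t v) = inner ℂ (J t u) (J t (T t v))

/-- Near `0`, the family `T z` is diagonalized by an analytic basis. -/
def HasAnalyticEigenbasis (T : ℂ → V →L[ℂ] V) : Prop :=
  ∃ (ι : Type) (_ : Fintype ι) (b : Module.Basis ι ℂ V) (e : ι → ℂ → V) (l : ι → ℂ → ℂ),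
    (∀ j, AnalyticAt ℂ (e j) 0) ∧ (∀ j, AnalyticAt ℂ (l j) 0) ∧ (∀ j, e j 0 = b j) ∧
      ∀ᶠ z in 𝓝 0, ∀ j, T z (e j z) = l j z • e j z

theorem tendsto_ofReal_zero : Tendsto (fun t : ℝ => (t : ℂ)) (𝓝 0) (𝓝 0) := by
  simpa using Complex.continuous_ofReal.tendsto 0

theorem conj_eq_of_symmetric_eigenvector {A : V →L[ℂ] V} {J : V →L[ℂ] H}
    (hJ : Function.Injective J) (hA : ∀ u v, inner ℂ (J (A u)) (J v) = inner ℂ (J u) (J (A v)))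
    {μ : ℂ} {v : V} (hv : v ≠ 0) (h : A v = μ • v) : (starRingEnd ℂ) μ = μ := by
  have h1 := hA v v
  rw [h, map_smul, inner_smul_left, inner_smul_right] at h1
  refine mul_right_cancel₀ (inner_self_ne_zero.2 fun h0 => hv (hJ ?_)) h1
  rw [h0, map_zero]

/-- The trace is the sum of the eigenvalues, each of which is real. -/
theorem conj_trace_of_symmetric {A : V →L[ℂ] V} {J : V →L[ℂ] H}
    (hJ : Function.Injective J) (hA : ∀ u v, inner ℂ (J (A u)) (J v) = inner ℂ (J u) (J (A v))) :
    (starRingEnd ℂ) (LinearMap.trace ℂ V A.toLinearMap) = LinearMap.trace ℂ V A.toLinearMap := by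
  rw [Module.End.trace_eq_sum_roots_charpoly_of_splits
    (IsAlgClosed.splits (LinearMap.charpoly A.toLinearMap)), map_multiset_sum]
  congr 1
  conv_rhs => rw [← Multiset.map_id (LinearMap.charpoly A.toLinearMap).roots]
  refine Multiset.map_congr rfl fun μ hμ => ?_
  have h2 : Module.End.HasEigenvalue A.toLinearMap μ :=
    (Module.End.hasEigenvalue_iff_isRoot_charpoly _ _).2 (Polynomial.isRoot_of_mem_roots hμ)
  obtain ⟨v, hv⟩ := h2.exists_hasEigenvector
  exact conj_eq_of_symmetric_eigenvector hJ hA hv.2 hv.apply_eq_smul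

/-- If `A x = 0` and `x = A y`, then `⟨Jx, Jx⟩ = ⟨J A x, J y⟩ = 0`. Rank-nullity does the rest. -/
theorem isCompl_ker_range_of_symmetric {A : V →L[ℂ] V} {J : V →L[ℂ] H}
    (hJ : Function.Injective J) (hA : ∀ u v, inner ℂ (J (A u)) (J v) = inner ℂ (J u) (J (A v))) :
    IsCompl (LinearMap.ker A.toLinearMap) (LinearMap.range A.toLinearMap) := by
  rw [Submodule.isCompl_iff_disjoint _ _ (by
    rw [add_comm, LinearMap.finrank_range_add_finrank_ker])]
  rw [Submodule.disjoint_def]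
  rintro x hx ⟨y, hy⟩
  apply hJ
  rw [map_zero, ← inner_self_eq_zero (𝕜 := ℂ)]
  have hx' : A x = 0 := hx
  have hy' : A y = x := hy
  have := hA x y
  rw [hx', hy', map_zero, inner_zero_left] at this
  exact this.symm

/-- Allows the scalar part of a family to be subtracted and a power of `z` to be divided out. -/
theorem HasAnalyticEigenbasis.smul_add {T S : ℂ → V →L[ℂ] V} {a c : ℂ → ℂ}
    (hS : HasAnalyticEigenbasis S) (ha : AnalyticAt ℂ a 0) (hc : AnalyticAt ℂ c 0)
    (h : ∀ᶠ z in 𝓝 0, T z = c z • 1 + a z • S z) : HasAnalyticEigenbasis T := by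
  obtain ⟨ι, _, b, e, l, he, hl, heb, h2⟩ := hS
  refine ⟨ι, inferInstance, b, e, fun j z => c z + a z * l j z, he,
    fun j => hc.add (ha.mul (hl j)), heb, ?_⟩
  filter_upwards [h, h2] with z hz1 hz2 j
  simp [hz1, hz2 j, add_smul, mul_smul]

theorem hasAnalyticEigenbasis_zero : HasAnalyticEigenbasis (fun _ : ℂ => (0 : V →L[ℂ] V)) :=
  ⟨_, inferInstance, Module.finBasis ℂ V, fun j _ => Module.finBasis ℂ V j, fun _ _ => 0,
    fun _ => analyticAt_const, fun _ => analyticAt_const, fun _ => rfl, by simp⟩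

/-- If complementary subspaces are invariant under `D z`, and `D` is similar to `T` via `U`, then
an eigenbasis of `T` is assembled from those of the restrictions of `D`. -/
theorem HasAnalyticEigenbasis.of_isCompl {T U D : ℂ → V →L[ℂ] V} {p q : Submodule ℂ V}
    (h : IsCompl p q) (hU : AnalyticAt ℂ U 0) (hU0 : U 0 = 1)
    (hTU : ∀ᶠ z in 𝓝 0, T z * U z = U z * D z)
    {D₁ : ℂ → p →L[ℂ] p} {D₂ : ℂ → q →L[ℂ] q}
    (h₁ : ∀ z (x : p), (D₁ z x : V) = D z x) (h₂ : ∀ z (x : q), (D₂ z x : V) = D z x)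
    (hD₁ : HasAnalyticEigenbasis D₁) (hD₂ : HasAnalyticEigenbasis D₂) :
    HasAnalyticEigenbasis T := by
  obtain ⟨ι₁, _, b₁, e₁, l₁, he₁, hl₁, heb₁, hz₁⟩ := hD₁
  obtain ⟨ι₂, _, b₂, e₂, l₂, he₂, hl₂, heb₂, hz₂⟩ := hD₂
  refine ⟨ι₁ ⊕ ι₂, inferInstance, (b₁.prod b₂).map (Submodule.prodEquivOfIsCompl p q h),
    Sum.elim (fun j z => U z (e₁ j z)) (fun j z => U z (e₂ j z)), Sum.elim l₁ l₂, ?_, ?_, ?_, ?_⟩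
  · rintro (j | j)
    · exact hU.clm_apply ((p.subtypeL.analyticAt _).fun_comp (he₁ j))
    · exact hU.clm_apply ((q.subtypeL.analyticAt _).fun_comp (he₂ j))
  · rintro (j | j)
    · exact hl₁ j
    · exact hl₂ j
  · rintro (j | j)
    · simp [hU0, heb₁]
    · simp [hU0, heb₂]
  · filter_upwards [hTU, hz₁, hz₂] with z hz h1 h2
    have key : ∀ x, T z (U z x) = U z (D z x) := fun x => DFunLike.congr_fun hz x
    rintro (j | j)
    · simp only [Sum.elim_inl]
      rw [key, ← h₁, h1 j]; simp
    · simp only [Sum.elim_inr]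
      rw [key, ← h₂, h2 j]; simp

/-- The similarity `U` is not unitary, so the blocks of `D` are symmetric only for the form pulled
back through `J z ∘ U z`. This is why the embedding is allowed to vary with `z`. -/
theorem IsSymmetricFamily.restrict {T U D : ℂ → V →L[ℂ] V} {J : ℂ → V →L[ℂ] H}
    (hT : IsSymmetricFamily T J) (hU : AnalyticAt ℂ U 0) (hU0 : U 0 = 1)
    (hD : AnalyticAt ℂ D 0) (hTU : ∀ᶠ z in 𝓝 0, T z * U z = U z * D z)
    {p : Submodule ℂ V} (π : V →L[ℂ] p) (hπ : ∀ z (x : p), (π (D z x) : V) = D z x) :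
    IsSymmetricFamily (fun z => (π ∘L D z) ∘L p.subtypeL)
      (fun z => (J z ∘L U z) ∘L p.subtypeL) where
  analytic := AnalyticAt.clm_comp (AnalyticAt.clm_comp analyticAt_const hD) analyticAt_const
  analytic_embedding := AnalyticAt.clm_comp (hT.analytic_embedding.clm_comp hU) analyticAt_const
  injective := by
    intro x y hxy
    simpa [hU0, hT.injective.eq_iff] using hxy
  symm := by
    filter_upwards [hT.symm, tendsto_ofReal_zero.eventually hTU] with t ht hz u v
    have key : ∀ x, U t (D t x) = T t (U t x) := fun x => (DFunLike.congr_fun hz x).symm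
    simp [hπ, key, ht]

/-- Rellich's theorem: an analytic family of operators which is symmetric on the real axis is
diagonalized by an analytic basis. -/
theorem IsSymmetricFamily.hasAnalyticEigenbasis {H : Type*} [NormedAddCommGroup H]
    [InnerProductSpace ℂ H] (d : ℕ) : ∀ (V : Type*) [NormedAddCommGroup V] [NormedSpace ℂ V]
    [FiniteDimensional ℂ V] (T : ℂ → V →L[ℂ] V) (J : ℂ → V →L[ℂ] H),
    Module.finrank ℂ V = d → IsSymmetricFamily T J → HasAnalyticEigenbasis T := by
  induction d using Nat.strong_induction_on with
  | _ d ih =>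
  intro V _ _ _ T J hd hT
  -- The scalar part of `T` is its normalized trace, real on the real axis. Removing it leaves a
  -- traceless family.
  obtain ⟨c, hc, hcT, hcr⟩ : ∃ c : ℂ → ℂ, AnalyticAt ℂ c 0 ∧
      (∀ z, (d : ℂ) * c z = LinearMap.trace ℂ V (T z).toLinearMap) ∧
      ∀ᶠ t : ℝ in 𝓝 0, (starRingEnd ℂ) (c t) = c t := by
    let trL : (V →L[ℂ] V) →L[ℂ] ℂ :=
      LinearMap.toContinuousLinearMap (LinearMap.trace ℂ V ∘ₗ ContinuousLinearMap.coeLM ℂ)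
    have htrL : ∀ X : V →L[ℂ] V, trL X = LinearMap.trace ℂ V X.toLinearMap := fun X => rfl
    refine ⟨fun z => (d : ℂ)⁻¹ * trL (T z),
      analyticAt_const.mul ((trL.analyticAt _).fun_comp hT.analytic), fun z => ?_, ?_⟩
    · beta_reduce
      rcases eq_or_ne d 0 with h0 | h0
      · have : Subsingleton V := Module.finrank_zero_iff.1 (hd.trans h0)
        rw [← htrL, Subsingleton.elim (T z) 0, map_zero, mul_zero, mul_zero]
      · rw [htrL, mul_inv_cancel_left₀ (Nat.cast_ne_zero.2 h0)]
    · have hinj : ∀ᶠ z in 𝓝 0, Function.Injective (J z) :=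
        hT.analytic_embedding.continuousAt.eventually
          (ContinuousLinearMap.isOpen_injective.mem_nhds hT.injective)
      filter_upwards [hT.symm, tendsto_ofReal_zero.eventually hinj] with t ht hJt
      rw [map_mul, htrL, conj_trace_of_symmetric hJt ht]
      simp
  set S : ℂ → V →L[ℂ] V := fun z => T z - c z • 1 with hS
  have hSan : AnalyticAt ℂ S 0 := hT.analytic.sub (hc.smul analyticAt_const)
  by_cases hS0 : ∀ᶠ z in 𝓝 0, S z = 0
  · refine hasAnalyticEigenbasis_zero.smul_add (a := 0) analyticAt_const hc ?_
    filter_upwards [hS0] with z hz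
    simpa [hS, sub_eq_zero] using hz
  obtain ⟨m, S₁, hS₁an, hS₁0, hS₁⟩ := hSan.exists_eventuallyEq_pow_smul_nonzero_iff.2 hS0
  simp only [sub_zero] at hS₁
  refine HasAnalyticEigenbasis.smul_add (S := S₁) (a := fun z => z ^ m) ?_ (by fun_prop) hc (by
    filter_upwards [hS₁] with z hz
    rw [← hz]; simp [hS])
  have hS₁sym : IsSymmetricFamily S₁ J := by
    refine ⟨hS₁an, hT.analytic_embedding, hT.injective, ?_⟩
    -- Off `t = 0` symmetry survives division by the real number `t ^ m`; at `t = 0` it follows by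
    -- continuity.
    have hne : ∀ᶠ t : ℝ in 𝓝[≠] 0, ∀ u v,
        inner ℂ (J t (S₁ t u)) (J t v) = inner ℂ (J t u) (J t (S₁ t v)) := by
      filter_upwards [nhdsWithin_le_nhds hT.symm,
        nhdsWithin_le_nhds (tendsto_ofReal_zero.eventually hS₁), nhdsWithin_le_nhds hcr,
        self_mem_nhdsWithin] with t h1 h2 h3 ht u v
      have ht' : ((t : ℂ) ^ m) ≠ 0 := pow_ne_zero _ (Complex.ofReal_ne_zero.2 ht)
      have e : ∀ x, (t : ℂ) ^ m • S₁ t x = T t x - c t • x := fun x => by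
        simpa [hS] using (DFunLike.congr_fun h2 x).symm
      refine mul_left_cancel₀ ht' ?_
      have e1 : (starRingEnd ℂ) ((t : ℂ) ^ m) = (t : ℂ) ^ m := by simp
      nth_rewrite 1 [← e1]
      rw [← inner_smul_left, ← inner_smul_right, ← (J t).map_smul, ← (J t).map_smul, e, e]
      simp only [map_sub, map_smul, inner_sub_left, inner_sub_right, h1 u v, inner_smul_left,
        inner_smul_right, h3]
    have h0 : ∀ u v, inner ℂ (J (0 : ℝ) (S₁ (0 : ℝ) u)) (J (0 : ℝ) v) =
        inner ℂ (J (0 : ℝ) u) (J (0 : ℝ) (S₁ (0 : ℝ) v)) := fun u v => by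
      have hc0 : ContinuousAt (fun t : ℝ => (t : ℂ)) 0 := Complex.continuous_ofReal.continuousAt
      have hJc : ContinuousAt (fun t : ℝ => J t) 0 :=
        ContinuousAt.comp' (g := J) (by simpa using hT.analytic_embedding.continuousAt) hc0
      have hSc : ContinuousAt (fun t : ℝ => S₁ t) 0 :=
        ContinuousAt.comp' (g := S₁) (by simpa using hS₁an.continuousAt) hc0
      have c1 : ContinuousAt (fun t : ℝ => inner ℂ (J t (S₁ t u)) (J t v)) 0 :=
        (hJc.clm_apply (hSc.clm_apply continuousAt_const)).inner (𝕜 := ℂ)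
          (hJc.clm_apply continuousAt_const)
      have c2 : ContinuousAt (fun t : ℝ => inner ℂ (J t u) (J t (S₁ t v))) 0 :=
        (hJc.clm_apply continuousAt_const).inner (𝕜 := ℂ)
          (hJc.clm_apply (hSc.clm_apply continuousAt_const))
      exact tendsto_nhds_unique_of_eventuallyEq (c1.tendsto.mono_left nhdsWithin_le_nhds)
        (c2.tendsto.mono_left nhdsWithin_le_nhds) (hne.mono fun t ht => ht u v)
    filter_upwards [eventually_nhdsWithin_iff.1 hne] with t ht
    rcases eq_or_ne t 0 with rfl | h
    · exact h0
    · exact ht h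
  have htr : LinearMap.trace ℂ V (S₁ 0).toLinearMap = 0 := by
    let trL : (V →L[ℂ] V) →L[ℂ] ℂ :=
      LinearMap.toContinuousLinearMap (LinearMap.trace ℂ V ∘ₗ ContinuousLinearMap.coeLM ℂ)
    have htrL : ∀ X : V →L[ℂ] V, trL X = LinearMap.trace ℂ V X.toLinearMap := fun X => rfl
    have c1 : ContinuousAt (fun z => trL (S₁ z)) 0 :=
      trL.continuous.continuousAt.comp' hS₁an.continuousAt
    rw [← htrL]
    refine tendsto_nhds_unique_of_eventuallyEq (l := 𝓝[≠] (0 : ℂ))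
      (c1.tendsto.mono_left nhdsWithin_le_nhds) tendsto_const_nhds ?_
    filter_upwards [nhdsWithin_le_nhds hS₁, self_mem_nhdsWithin] with z hz hz0
    refine (mul_eq_zero.1 (?_ : z ^ m * trL (S₁ z) = 0)).resolve_left (pow_ne_zero _ hz0)
    have h1 : LinearMap.trace ℂ V ((1 : V →L[ℂ] V) : V →ₗ[ℂ] V) = d := by
      rw [← hd]; exact LinearMap.trace_id ℂ V
    rw [← smul_eq_mul, ← map_smul, ← hz]
    simp only [hS, map_sub, map_smul]
    rw [htrL, htrL, h1, ← hcT, smul_eq_mul]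
    ring
  -- A traceless scalar operator is zero, but `S₁ 0 ≠ 0`. Hence every eigenspace of `S₁ 0` is
  -- proper, which lets the induction on the dimension proceed.
  have hns : ∀ μ : ℂ, S₁ 0 ≠ μ • 1 := by
    intro μ hμ
    have h1 : LinearMap.trace ℂ V ((1 : V →L[ℂ] V) : V →ₗ[ℂ] V) = d := by
      rw [← hd]; exact LinearMap.trace_id ℂ V
    rw [hμ, ContinuousLinearMap.toLinearMap_smul, map_smul, h1, smul_eq_mul, mul_eq_zero,
      Nat.cast_eq_zero] at htr
    rcases htr with h | h
    · exact hS₁0 (by rw [hμ, h, zero_smul])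
    · have : Subsingleton V := Module.finrank_zero_iff.1 (hd.trans h)
      exact hS₁0 (Subsingleton.elim _ _)
  have hsym0 : ∀ u v, inner ℂ (J 0 (S₁ 0 u)) (J 0 v) = inner ℂ (J 0 u) (J 0 (S₁ 0 v)) := by
    simpa using hS₁sym.symm.self_of_nhds
  have hV : Nontrivial V := by
    by_contra hV
    rw [not_nontrivial_iff_subsingleton] at hV
    exact hns 0 (Subsingleton.elim _ _)
  obtain ⟨μ, hμ⟩ := Module.End.exists_eigenvalue (S₁ 0).toLinearMap
  obtain ⟨v, hv⟩ := hμ.exists_hasEigenvector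
  have hμr : (starRingEnd ℂ) μ = μ :=
    conj_eq_of_symmetric_eigenvector hT.injective hsym0 hv.2 hv.apply_eq_smul
  set A : V →L[ℂ] V := S₁ 0 - μ • 1 with hA
  have hAsym : ∀ u v, inner ℂ (J 0 (A u)) (J 0 v) = inner ℂ (J 0 u) (J 0 (A v)) := fun u v => by
    simp [hA, hsym0, hμr, mul_comm]
  have hcompl := isCompl_ker_range_of_symmetric hT.injective hAsym
  set p := LinearMap.ker A.toLinearMap with hp
  set q := LinearMap.range A.toLinearMap with hq
  have hvp : v ∈ p := by
    simpa [hp, hA, sub_eq_zero] using hv.apply_eq_smul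
  have hp0 : 0 < Module.finrank ℂ p := by
    have : Nontrivial p := ⟨⟨v, hvp⟩, 0, fun h => hv.2 (congrArg Subtype.val h)⟩
    exact Module.finrank_pos
  have hq0 : 0 < Module.finrank ℂ q := by
    have : q ≠ ⊥ := fun h => by
      rw [hq, LinearMap.range_eq_bot] at h
      refine hns μ ?_
      ext x
      simpa [hA, sub_eq_zero] using DFunLike.congr_fun h x
    have := Submodule.nontrivial_iff_ne_bot.2 this
    exact Module.finrank_pos
  have hpq : Module.finrank ℂ p + Module.finrank ℂ q = d := by
    rw [← hd]; exact Submodule.finrank_add_eq_of_isCompl hcompl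
  set P : V →L[ℂ] V := (p.projection q hcompl).toContinuousLinearMap with hP
  have hPp : ∀ x ∈ p, P x = x := fun x hx => by
    simp [hP, Submodule.projection_apply, Submodule.projectionOnto_apply_of_mem_left hcompl hx]
  have hPq : ∀ x ∈ q, P x = 0 := fun x hx => by
    simp [hP, Submodule.projection_apply, Submodule.projectionOnto_apply_of_mem_right hcompl hx]
  -- Whatever commutes with `S₁ 0` preserves the kernel and the range of `A`, hence commutes with
  -- the projection along this splitting.
  have hAcomm : ∀ X : V →L[ℂ] V, S₁ 0 * X = X * S₁ 0 → P * X = X * P := by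
    intro X hX
    have hXA : ∀ x, A (X x) = X (A x) := fun x => by
      have := DFunLike.congr_fun hX x
      simp only [mul_apply_eq_comp] at this
      simp [hA, this]
    ext x
    obtain ⟨a, ha, b, hb, rfl⟩ := Submodule.mem_sup.1
      (hcompl.sup_eq_top ▸ Submodule.mem_top : x ∈ p ⊔ q)
    have hXa : X a ∈ p := by
      have ha' : A a = 0 := ha
      have : A (X a) = 0 := by rw [hXA, ha', map_zero]
      exact this
    have hXb : X b ∈ q := by
      obtain ⟨y, hy⟩ := hb
      exact ⟨X y, (hXA y).trans (congrArg X hy)⟩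
    simp only [mul_apply_eq_comp, map_add, hPp a ha, hPq b hb, hPp _ hXa, hPq _ hXb,
      map_zero]
  have hPS : P * S₁ 0 = S₁ 0 * P := hAcomm _ rfl
  have hPP : P * P = P := by
    ext x; simp [hP]
  obtain ⟨U, D, hU, hD, hU0, hUD, hPD⟩ :=
    exists_analytic_block_diagonalization hS₁an hPP hPS hAcomm
  let π₁ : V →L[ℂ] p := (p.projectionOnto q hcompl).toContinuousLinearMap
  let π₂ : V →L[ℂ] q := (q.projectionOnto p hcompl.symm).toContinuousLinearMap
  have h₁ : ∀ z (x : p), (π₁ (D z x) : V) = D z x := by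
    intro z x
    have := DFunLike.congr_fun (hPD z) (x : V)
    simp only [mul_apply_eq_comp, hPp _ x.2] at this
    exact this
  have h₂ : ∀ z (x : q), (π₂ (D z x) : V) = D z x := by
    intro z x
    have := DFunLike.congr_fun (hPD z) (x : V)
    simp only [mul_apply_eq_comp, hPq _ x.2, map_zero] at this
    have hmem : D z x ∈ q := by
      rw [← Submodule.projectionOnto_apply_eq_zero_iff hcompl]
      exact Subtype.ext this
    exact congrArg Subtype.val (Submodule.projectionOnto_apply_of_mem_left hcompl.symm hmem)
  exact HasAnalyticEigenbasis.of_isCompl hcompl hU hU0 hUD h₁ h₂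
    (ih _ (by omega) p _ _ rfl (hS₁sym.restrict hU hU0 hD hUD π₁ h₁))
    (ih _ (by omega) q _ _ rfl (hS₁sym.restrict hU hU0 hD hUD π₂ h₂))

end AnalyticEigenbasis

/-! ### Monotonicity and limits of the quality factor -/

section QualityFactor

/-- A nonzero germ is `x ^ n` times a function not vanishing at `0`, whose sign there decides. -/
theorem AnalyticAt.eventually_sign {f : ℝ → ℝ} (hf : AnalyticAt ℝ f 0) :
    (∀ᶠ x in 𝓝[>] 0, f x = 0) ∨ (∀ᶠ x in 𝓝[>] 0, 0 < f x) ∨ ∀ᶠ x in 𝓝[>] 0, f x < 0 := by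
  by_cases h : ∀ᶠ x in 𝓝 0, f x = 0
  · exact Or.inl (nhdsWithin_le_nhds h)
  obtain ⟨n, g, hg, hg0, hfg⟩ := hf.exists_eventuallyEq_pow_smul_nonzero_iff.2 h
  refine Or.inr (hg0.lt_or_gt.symm.imp (fun h0 => ?_) fun h0 => ?_)
  · filter_upwards [nhdsWithin_le_nhds hfg, self_mem_nhdsWithin,
      nhdsWithin_le_nhds (hg.continuousAt.eventually (lt_mem_nhds h0))] with x h1 h2 h3
    have h2' : 0 < x := h2
    rw [h1, sub_zero, smul_eq_mul]
    positivity
  · filter_upwards [nhdsWithin_le_nhds hfg, self_mem_nhdsWithin,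
      nhdsWithin_le_nhds (hg.continuousAt.eventually (gt_mem_nhds h0))] with x h1 h2 h3
    have h2' : 0 < x := h2
    rw [h1, sub_zero, smul_eq_mul]
    exact mul_neg_of_pos_of_neg (by positivity) h3

theorem exists_Ioo_of_eventually {p : ℝ → Prop} (h : ∀ᶠ x in 𝓝[>] 0, p x) :
    ∃ δ > 0, ∀ x ∈ Ioo (0 : ℝ) δ, p x := by
  obtain ⟨δ, hδ, h'⟩ := (mem_nhdsGT_iff_exists_Ioo_subset).1 h
  exact ⟨δ, hδ, h'⟩

/-- A quotient of real analytic functions is, on the right of a point, constant or strictly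
monotone. -/
theorem exists_constant_or_strictMonoOn_div {a s : ℝ → ℝ} (ha : AnalyticAt ℝ a 0)
    (hs : AnalyticAt ℝ s 0) (hs0 : ∀ᶠ x in 𝓝[>] 0, 0 < s x) :
    ∃ δ > 0, (∃ c, ∀ x ∈ Ioo 0 δ, a x / s x = c) ∨
      StrictMonoOn (fun x => a x / s x) (Ioo 0 δ) ∨
      StrictAntiOn (fun x => a x / s x) (Ioo 0 δ) := by
  -- The numerator of the derivative of `a / s` is analytic, so it has a fixed sign or vanishes
  -- identically.
  have hW : AnalyticAt ℝ (fun x => deriv a x * s x - a x * deriv s x) 0 :=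
    (ha.deriv.mul hs).sub (ha.mul hs.deriv)
  have hd : ∀ᶠ x in 𝓝[>] 0, 0 < s x ∧
      HasDerivAt (fun x => a x / s x) ((deriv a x * s x - a x * deriv s x) / s x ^ 2) x := by
    filter_upwards [hs0, nhdsWithin_le_nhds ha.eventually_analyticAt,
      nhdsWithin_le_nhds hs.eventually_analyticAt] with x h1 h2 h3
    exact ⟨h1, h2.differentiableAt.hasDerivAt.div h3.differentiableAt.hasDerivAt h1.ne'⟩
  rcases hW.eventually_sign with h | h | h
  · obtain ⟨δ, hδ, H⟩ := exists_Ioo_of_eventually (hd.and h)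
    refine ⟨δ, hδ, Or.inl ⟨a (δ / 2) / s (δ / 2), fun x hx => ?_⟩⟩
    refine isOpen_Ioo.is_const_of_deriv_eq_zero (f := fun x => a x / s x) isPreconnected_Ioo
      (fun y hy => (H y hy).1.2.differentiableAt.differentiableWithinAt) (fun y hy => ?_) hx
      ⟨by positivity, by linarith⟩
    rw [(H y hy).1.2.deriv, (H y hy).2, zero_div]; rfl
  · obtain ⟨δ, hδ, H⟩ := exists_Ioo_of_eventually (hd.and h)
    refine ⟨δ, hδ, Or.inr (Or.inl ?_)⟩
    refine strictMonoOn_of_deriv_pos (convex_Ioo _ _)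
      (fun y hy => (H y hy).1.2.continuousAt.continuousWithinAt) fun y hy => ?_
    rw [interior_Ioo] at hy
    have h1 := (H y hy).1.1
    rw [(H y hy).1.2.deriv]
    exact div_pos (H y hy).2 (by positivity)
  · obtain ⟨δ, hδ, H⟩ := exists_Ioo_of_eventually (hd.and h)
    refine ⟨δ, hδ, Or.inr (Or.inr ?_)⟩
    refine strictAntiOn_of_deriv_neg (convex_Ioo _ _)
      (fun y hy => (H y hy).1.2.continuousAt.continuousWithinAt) fun y hy => ?_
    rw [interior_Ioo] at hy
    have h1 := (H y hy).1.1
    rw [(H y hy).1.2.deriv]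
    exact div_neg_of_neg_of_pos (H y hy).2 (by positivity)

theorem analyticAt_re_ofReal {h : ℂ → ℂ} (hh : AnalyticAt ℂ h 0) :
    AnalyticAt ℝ (fun x : ℝ => (h x).re) 0 :=
  (Complex.reCLM.analyticAt _).fun_comp
    (AnalyticAt.fun_comp (g := h) (by simpa using hh.restrictScalars) (Complex.ofRealCLM.analyticAt 0))

theorem analyticAt_im_ofReal {h : ℂ → ℂ} (hh : AnalyticAt ℂ h 0) :
    AnalyticAt ℝ (fun x : ℝ => (h x).im) 0 :=
  (Complex.imCLM.analyticAt _).fun_comp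
    (AnalyticAt.fun_comp (g := h) (by simpa using hh.restrictScalars) (Complex.ofRealCLM.analyticAt 0))

/-- The germ at `β = ∞` of the quality factor of a meromorphic function is constant or strictly
monotone. -/
theorem qFactor_eventually_constant_or_strict {h : ℂ → ℂ} (hh : AnalyticAt ℂ h 0) (n : ℕ)
    {ζ : ℝ → ℂ} (hζ : ∀ᶠ β : ℝ in atTop, ζ β = (β : ℂ) ^ n * h (β : ℂ)⁻¹)
    (him : ∀ᶠ β in atTop, (ζ β).im ≤ 0) :
    ∃ b : ℝ, (∃ c, ∀ β ∈ Ici b, qFactor (ζ β) = c) ∨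
      StrictAntiOn (fun β => qFactor (ζ β)) (Ici b) ∨
      StrictMonoOn (fun β => qFactor (ζ β)) (Ici b) := by
  have hr := analyticAt_re_ofReal hh
  have hs : AnalyticAt ℝ (fun x : ℝ => -(h x).im) 0 := (analyticAt_im_ofReal hh).neg
  have hζ' : ∀ᶠ β : ℝ in atTop, 0 < β ∧ (ζ β).re = β ^ n * (h (β⁻¹ : ℝ)).re ∧
      (ζ β).im = β ^ n * (h (β⁻¹ : ℝ)).im := by
    filter_upwards [hζ, eventually_gt_atTop 0] with β h1 h2
    refine ⟨h2, ?_, ?_⟩ <;> rw [h1] <;> rw [← Complex.ofReal_pow, ← Complex.ofReal_inv]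
    · rw [Complex.re_ofReal_mul]
    · rw [Complex.im_ofReal_mul]
  have key : ∀ c : ℝ≥0∞, (∀ᶠ β in atTop, qFactor (ζ β) = c) → ∃ b : ℝ,
      (∃ c, ∀ β ∈ Ici b, qFactor (ζ β) = c) ∨
      StrictAntiOn (fun β => qFactor (ζ β)) (Ici b) ∨
      StrictMonoOn (fun β => qFactor (ζ β)) (Ici b) := fun c hc => by
    obtain ⟨b, hb⟩ := eventually_atTop.1 hc
    exact ⟨b, Or.inl ⟨c, hb⟩⟩
  by_cases hr0 : ∀ᶠ x : ℝ in 𝓝[>] 0, (h x).re = 0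
  · refine key 0 ?_
    filter_upwards [hζ', tendsto_inv_atTop_nhdsGT_zero.eventually hr0, him] with β h1 h2 h3
    have : (ζ β).re = 0 := by rw [h1.2.1, h2, mul_zero]
    by_cases h0 : ζ β = 0
    · simp [qFactor, h0]
    · have : (ζ β).im ≠ 0 := fun h => h0 (Complex.ext this h)
      simp [qFactor, h0, this, ‹(ζ β).re = 0›]
  -- The real part keeps a fixed sign, so its absolute value is again analytic on the right of `0`.
  obtain ⟨a, ha, hra⟩ : ∃ a : ℝ → ℝ, AnalyticAt ℝ a 0 ∧
      ∀ᶠ x : ℝ in 𝓝[>] 0, 0 < a x ∧ |(h x).re| = a x := by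
    rcases hr.eventually_sign with h1 | h1 | h1
    · exact absurd h1 hr0
    · exact ⟨_, hr, h1.mono fun x hx => ⟨hx, abs_of_pos hx⟩⟩
    · exact ⟨_, hr.neg, h1.mono fun x hx => ⟨neg_pos.2 hx, abs_of_neg hx⟩⟩
  have hre0 : ∀ᶠ β in atTop, (ζ β).re ≠ 0 := by
    filter_upwards [hζ', tendsto_inv_atTop_nhdsGT_zero.eventually hra] with β h1 h2
    rw [h1.2.1]
    exact mul_ne_zero (pow_ne_zero _ h1.1.ne') (abs_pos.1 (h2.2 ▸ h2.1))
  rcases hs.eventually_sign with h1 | h1 | h1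
  · refine key ⊤ ?_
    filter_upwards [hζ', tendsto_inv_atTop_nhdsGT_zero.eventually h1, hre0] with β h1 h2 h3
    have h0 : ζ β ≠ 0 := fun h => h3 (by rw [h, Complex.zero_re])
    have him0 : (ζ β).im = 0 := by rw [h1.2.2, neg_eq_zero.1 h2, mul_zero]
    simp [qFactor, h0, him0]
  · obtain ⟨δ, hδ, H⟩ := exists_constant_or_strictMonoOn_div ha hs h1
    have hq : ∀ᶠ β : ℝ in atTop, 0 < β ∧ β⁻¹ ∈ Ioo 0 δ ∧ 0 < a β⁻¹ / -(h (β⁻¹ : ℝ)).im ∧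
        qFactor (ζ β) = ENNReal.ofReal (1 / 2 * (a β⁻¹ / -(h (β⁻¹ : ℝ)).im)) := by
      filter_upwards [hζ', tendsto_inv_atTop_nhdsGT_zero.eventually h1, hre0,
        tendsto_inv_atTop_nhdsGT_zero.eventually hra,
        tendsto_inv_atTop_nhdsGT_zero.eventually (Ioo_mem_nhdsGT hδ)] with β h1 h2 h3 h4 h5
      refine ⟨h1.1, h5, div_pos h4.1 h2, ?_⟩
      have h0 : ζ β ≠ 0 := fun h => h3 (by rw [h, Complex.zero_re])
      have hp : 0 < β ^ n := pow_pos h1.1 n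
      have h2' : (h (β⁻¹ : ℝ)).im ≠ 0 := (neg_pos.1 h2).ne
      have him0 : (ζ β).im ≠ 0 := by
        rw [h1.2.2]; exact mul_ne_zero hp.ne' h2'
      rw [qFactor, if_neg h0, if_neg him0, h1.2.1, h1.2.2, abs_mul, abs_of_pos hp, h4.2,
        ← mul_neg, mul_div_mul_left _ _ hp.ne']
    obtain ⟨b, hb⟩ := eventually_atTop.1 hq
    refine ⟨b, ?_⟩
    -- Passing from `x = β⁻¹` to `β` exchanges increase and decrease.
    have hinv : ∀ x ∈ Ici b, ∀ y ∈ Ici b, x < y → y⁻¹ < x⁻¹ := fun x hx y hy hxy =>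
      (inv_lt_inv₀ (hb y hy).1 (hb x hx).1).2 hxy
    rcases H with ⟨c, hc⟩ | H | H
    · exact Or.inl ⟨ENNReal.ofReal (1 / 2 * c), fun β hβ => by
        rw [(hb β hβ).2.2.2, ← hc _ (hb β hβ).2.1]⟩
    · refine Or.inr (Or.inl fun x hx y hy hxy => ?_)
      have := H (hb y hy).2.1 (hb x hx).2.1 (hinv x hx y hy hxy)
      simp only [(hb x hx).2.2.2, (hb y hy).2.2.2]
      have hpos := (hb x hx).2.2.1
      exact (ENNReal.ofReal_lt_ofReal_iff (by positivity)).2 (by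
        simpa using this)
    · refine Or.inr (Or.inr fun x hx y hy hxy => ?_)
      have := H (hb y hy).2.1 (hb x hx).2.1 (hinv x hx y hy hxy)
      simp only [(hb x hx).2.2.2, (hb y hy).2.2.2]
      have hpos := (hb y hy).2.2.1
      exact (ENNReal.ofReal_lt_ofReal_iff (by positivity)).2 (by
        simpa using this)
  · exfalso
    have : ∀ᶠ β : ℝ in atTop, False := by
      filter_upwards [hζ', tendsto_inv_atTop_nhdsGT_zero.eventually h1, him] with β h1 h2 h3
      rw [h1.2.2] at h3
      have h2' : 0 < (h (β⁻¹ : ℝ)).im := neg_neg_iff_pos.1 h2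
      have := mul_pos (pow_pos h1.1 n) h2'
      linarith
    exact this.exists.elim fun _ h => h

/-- A constant must equal the limit, and a strictly increasing function with values in `[0, ∞]`
cannot tend to `0`. -/
theorem decreasesToZero_of_tendsto {f : ℝ → ℝ≥0∞} {b : ℝ}
    (h : (∃ c, ∀ β ∈ Ici b, f β = c) ∨ StrictAntiOn f (Ici b) ∨ StrictMonoOn f (Ici b))
    (hf : Tendsto f atTop (𝓝 0)) : DecreasesToZero f := by
  refine ⟨⟨b, ?_⟩, hf⟩
  rcases h with ⟨c, hc⟩ | h | h
  · have : c = 0 := tendsto_nhds_unique_of_eventuallyEq tendsto_const_nhds hf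
      (eventually_atTop.2 ⟨b, fun β hβ => (hc β hβ).symm⟩)
    exact Or.inl (this ▸ hc)
  · exact Or.inr h
  · exfalso
    have h1 : f b < f (b + 1) := h self_mem_Ici (by simp) (by simp)
    have h2 : f (b + 1) ≤ 0 := ge_of_tendsto hf (eventually_atTop.2 ⟨b + 1, fun x hx =>
      h.monotoneOn (by simp) (by simp only [mem_Ici]; linarith) hx⟩)
    exact not_lt_of_ge h2 (bot_le.trans_lt h1)

theorem increasesToTop_of_tendsto {f : ℝ → ℝ≥0∞} {b : ℝ}
    (h : (∃ c, ∀ β ∈ Ici b, f β = c) ∨ StrictAntiOn f (Ici b) ∨ StrictMonoOn f (Ici b))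
    (hf : Tendsto f atTop (𝓝 ⊤)) : IncreasesToTop f := by
  refine ⟨⟨b, ?_⟩, hf⟩
  rcases h with ⟨c, hc⟩ | h | h
  · have : c = ⊤ := tendsto_nhds_unique_of_eventuallyEq tendsto_const_nhds hf
      (eventually_atTop.2 ⟨b, fun β hβ => (hc β hβ).symm⟩)
    exact Or.inl (this ▸ hc)
  · exfalso
    have h1 : f (b + 1) < f b := h self_mem_Ici (by simp) (by simp)
    have h2 : ⊤ ≤ f (b + 1) := le_of_tendsto hf (eventually_atTop.2 ⟨b + 1, fun x hx =>
      h.antitoneOn (by simp) (by simp only [mem_Ici]; linarith) hx⟩)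
    exact not_lt_of_ge h2 (h1.trans_le le_top)
  · exact Or.inr h

theorem AnalyticAtInfinity.exists_eq_pow_mul {ζ : ℝ → ℂ} (h : AnalyticAtInfinity ζ) :
    ∃ (n : ℕ) (g : ℂ → ℂ), AnalyticAt ℂ g 0 ∧
      ∀ᶠ β : ℝ in atTop, ζ β = (β : ℂ) ^ n * g (β : ℂ)⁻¹ := by
  obtain ⟨g, hg, h⟩ := h
  exact ⟨0, g, hg, by simpa using h⟩

theorem HasPoleAtInfinity.exists_eq_pow_mul {ζ : ℝ → ℂ} (h : HasPoleAtInfinity ζ) :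
    ∃ (n : ℕ) (g : ℂ → ℂ), AnalyticAt ℂ g 0 ∧
      ∀ᶠ β : ℝ in atTop, ζ β = (β : ℂ) ^ n * g (β : ℂ)⁻¹ := by
  obtain ⟨g, ⟨n, hg⟩, -, h⟩ := h
  refine ⟨n, _, hg, ?_⟩
  filter_upwards [h, eventually_gt_atTop 0] with β h1 h2
  have : (β : ℂ) ≠ 0 := Complex.ofReal_ne_zero.2 h2.ne'
  rw [h1, sub_zero, smul_eq_mul, inv_pow, mul_inv_cancel_left₀ (pow_ne_zero _ this)]

theorem qFactor_le_of_im_neg {ζ : ℂ} {c : ℝ} (h : ζ = 0 ∨ ζ.im ≠ 0 ∧ |ζ.re| ≤ 2 * c * -ζ.im)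
    (him : ζ.im ≤ 0) : qFactor ζ ≤ ENNReal.ofReal c := by
  rcases h with h | ⟨h0, h⟩
  · simp [qFactor, h]
  · have h1 : ζ ≠ 0 := fun h => h0 (by rw [h, Complex.zero_im])
    rw [qFactor, if_neg h1, if_neg h0]
    refine ENNReal.ofReal_le_ofReal ?_
    have : 0 < -ζ.im := neg_pos.2 (lt_of_le_of_ne him h0)
    have := (div_le_iff₀ this).2 h
    linarith

theorem tendsto_qFactor_top {ζ : ℝ → ℂ} {ρ : ℝ} (hρ : ρ ≠ 0)
    (him : ∀ᶠ β in atTop, (ζ β).im ≤ 0) (h : Tendsto ζ atTop (𝓝 (ρ : ℂ))) :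
    Tendsto (fun β => qFactor (ζ β)) atTop (𝓝 ⊤) := by
  have hre : Tendsto (fun β => (ζ β).re) atTop (𝓝 ρ) :=
    (Complex.continuous_re.tendsto _).comp h
  have hi : Tendsto (fun β => (ζ β).im) atTop (𝓝 0) :=
    (Complex.continuous_im.tendsto _).comp h
  rw [ENNReal.tendsto_nhds_top_iff_nnreal]
  intro x
  have h1 : ∀ᶠ β in atTop, |ρ| / 2 < |(ζ β).re| :=
    hre.abs.eventually (lt_mem_nhds (half_lt_self (abs_pos.2 hρ)))
  -- With `|Re ζ| > |ρ| / 2` this bound makes the quality factor at least `x + 1`.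
  have h2 : ∀ᶠ β in atTop, -(|ρ| / (4 * (x + 1))) < (ζ β).im :=
    hi.eventually (lt_mem_nhds (neg_neg_iff_pos.2 (by positivity)))
  filter_upwards [h1, h2, him] with β h1 h2 h3
  have hr0 : (ζ β).re ≠ 0 := abs_pos.1 ((by positivity : 0 ≤ |ρ| / 2).trans_lt h1)
  have h0 : ζ β ≠ 0 := fun h => hr0 (by rw [h, Complex.zero_re])
  rw [qFactor, if_neg h0]
  split_ifs with h4
  · exact ENNReal.coe_lt_top
  · have h5 : 0 < -(ζ β).im := neg_pos.2 (lt_of_le_of_ne h3 h4)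
    rw [ENNReal.lt_ofReal_iff_toReal_lt ENNReal.coe_ne_top, ENNReal.coe_toReal]
    have h6 : (x + 1 : ℝ) * 2 ≤ |(ζ β).re| / -(ζ β).im := by
      rw [le_div_iff₀ h5]
      have : (x + 1 : ℝ) * 2 * -(ζ β).im ≤ (x + 1 : ℝ) * 2 * (|ρ| / (4 * (x + 1))) :=
        mul_le_mul_of_nonneg_left (by linarith) (by positivity)
      have e : (x + 1 : ℝ) * 2 * (|ρ| / (4 * (x + 1))) = |ρ| / 2 := by
        have : (x + 1 : ℝ) ≠ 0 := by positivity
        field_simp; norm_num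
      linarith
    linarith

end QualityFactor

/-! ### The pencil `B + zΩ`: perturbation theory and eigenvalue counts -/

section Pencil

variable {V : Type*} [NormedAddCommGroup V] [InnerProductSpace ℂ V] [FiniteDimensional ℂ V]

theorem exists_analytic_eigenbasis_pencil {B Ω : V →L[ℂ] V}
    (hB : ∀ u v, inner ℂ (B u) v = inner ℂ u (B v))
    (hΩ : ∀ u v, inner ℂ (Ω u) v = inner ℂ u (Ω v)) :
    HasAnalyticEigenbasis (fun z : ℂ => B + z • Ω) := by
  refine IsSymmetricFamily.hasAnalyticEigenbasis _ V _ (fun _ => ContinuousLinearMap.id ℂ V) rfl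
    ⟨analyticAt_const.add (analyticAt_id.smul analyticAt_const), analyticAt_const,
      fun x y h => h, Eventually.of_forall fun t u v => ?_⟩
  simp [hB, hΩ]

/-- First order perturbation theory: the derivative of an eigenvalue that vanishes at `0`. -/
theorem inner_pencil_first_order {B Ω : V →L[ℂ] V}
    (hB : ∀ u v, inner ℂ (B u) v = inner ℂ u (B v)) {e : ℂ → V} {l : ℂ → ℂ}
    (he : AnalyticAt ℂ e 0) (hl : AnalyticAt ℂ l 0)
    (h : ∀ᶠ z in 𝓝 0, (B + z • Ω) (e z) = l z • e z) (hl0 : l 0 = 0) {v : V} (hv : B v = 0) :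
    inner ℂ v (Ω (e 0)) = deriv l 0 * inner ℂ v (e 0) := by
  have he' := he.differentiableAt.hasDerivAt
  have hl' := hl.differentiableAt.hasDerivAt
  have d1 : HasDerivAt (fun z => (B + z • Ω) (e z)) (B (deriv e 0) + Ω (e 0)) 0 := by
    have h1 : HasDerivAt (fun z : ℂ => B (e z)) (B (deriv e 0)) 0 :=
      B.hasFDerivAt.comp_hasDerivAt 0 he'
    have h2 : HasDerivAt (fun z : ℂ => Ω (e z)) (Ω (deriv e 0)) 0 :=
      Ω.hasFDerivAt.comp_hasDerivAt 0 he'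
    have h3 := HasDerivAt.fun_add h1 (HasDerivAt.fun_smul (hasDerivAt_id (0 : ℂ)) h2)
    simpa using h3
  have d2 := (hl'.smul he').congr_of_eventuallyEq h
  have key := d1.unique d2
  rw [hl0, zero_smul, zero_add] at key
  -- Pairing with `v ∈ ker B` removes the unknown term `B (e' 0)`.
  have := congrArg (inner ℂ v) key
  rwa [inner_add_right, inner_smul_right, ← hB, hv, inner_zero_left, zero_add] at this

theorem finrank_span_basis_image {ι W : Type*} [Fintype ι] [AddCommGroup W] [Module ℂ W]
    (b : Module.Basis ι ℂ W) (p : ι → Prop) [DecidablePred p] :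
    Module.finrank ℂ (Submodule.span ℂ (b '' {j | p j})) = Fintype.card {j // p j} := by
  have h := finrank_span_eq_card (b.linearIndependent.comp (Subtype.val : {j // p j} → ι)
    Subtype.val_injective)
  rw [← h, range_comp, Subtype.range_coe_subtype]

theorem repr_apply_eigenbasis {ι W : Type*} [Fintype ι] [AddCommGroup W] [Module ℂ W]
    (b : Module.Basis ι ℂ W) {f : W →ₗ[ℂ] W} {l : ι → ℂ} (h : ∀ j, f (b j) = l j • b j) (u : W)
    (j : ι) : b.repr (f u) j = l j * b.repr u j := by
  conv_lhs => rw [← b.sum_repr u]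
  simp only [map_sum, map_smul, h, Finsupp.coe_finsetSum, Finset.sum_apply, Finsupp.smul_apply,
    b.repr_self, smul_eq_mul]
  rw [Finset.sum_eq_single j (fun i _ hi => by simp [hi]) (by simp)]
  simp [mul_comm]

theorem card_eq_zero_eigenvalues {ι W : Type*} [Fintype ι] [AddCommGroup W] [Module ℂ W]
    (b : Module.Basis ι ℂ W) {f : W →ₗ[ℂ] W} {l : ι → ℂ} (h : ∀ j, f (b j) = l j • b j)
    [DecidablePred fun j => l j = 0] :
    Fintype.card {j // l j = 0} = Module.finrank ℂ (LinearMap.ker f) := by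
  rw [← finrank_span_basis_image b]
  suffices hker : Submodule.span ℂ (b '' {j | l j = 0}) = LinearMap.ker f by rw [hker]
  · ext u
    rw [b.mem_span_image, LinearMap.mem_ker, ← b.repr.map_eq_zero_iff]
    constructor
    · intro hs
      ext j
      rw [repr_apply_eigenbasis b h]
      by_cases hj : b.repr u j = 0
      · simp [hj]
      · have : l j = 0 := hs (Finsupp.mem_support_iff.2 hj)
        simp [this]
    · intro hs j hj
      have := DFunLike.congr_fun hs j
      rw [repr_apply_eigenbasis b h] at this
      exact (mul_eq_zero.1 this).resolve_right (Finsupp.mem_support_iff.1 hj)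

/-- The vectors of `ker B` annihilated by the compression of `Ω` to `ker B`. -/
noncomputable def compressionKernel (B Ω : V →L[ℂ] V) : Submodule ℂ V :=
  LinearMap.ker B.toLinearMap ⊓ (LinearMap.ker B.toLinearMap)ᗮ.comap Ω.toLinearMap

/-- The hypothesis `ha` says weakly that the `b j` with `l j = 0` are eigenvectors of the compressed
`Ω`; no orthogonality is needed. For `u` in the compression kernel, the vector `v = ∑ a_j u_j b_j`
represents the compressed `Ω u`, so `⟨v, v⟩ = ⟨v, Ω u⟩ = 0` and every `a_j u_j` vanishes. -/
theorem card_zero_eigenvalues_compression {ι : Type*} [Fintype ι] (b : Module.Basis ι ℂ V)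
    {B Ω : V →L[ℂ] V} {l a : ι → ℂ} (h : ∀ j, B (b j) = l j • b j)
    (ha : ∀ j, l j = 0 → ∀ v, B v = 0 → inner ℂ v (Ω (b j)) = a j * inner ℂ v (b j))
    [DecidablePred fun j => l j = 0 ∧ a j = 0] :
    Fintype.card {j // l j = 0 ∧ a j = 0} = Module.finrank ℂ (compressionKernel B Ω) := by
  rw [← finrank_span_basis_image b]
  suffices hZ : Submodule.span ℂ (b '' {j | l j = 0 ∧ a j = 0}) = compressionKernel B Ω by rw [hZ]
  · apply le_antisymm
    · rw [Submodule.span_le]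
      rintro _ ⟨j, ⟨hj, haj⟩, rfl⟩
      refine ⟨?_, fun v hv => ?_⟩
      · exact (h j).trans (by rw [hj, zero_smul])
      · exact (ha j hj v hv).trans (by rw [haj, zero_mul])
    · rintro u ⟨hu, hu'⟩
      have hBu : B u = 0 := hu
      have hc : ∀ j, l j * b.repr u j = 0 := fun j => by
        rw [← repr_apply_eigenbasis b (f := B.toLinearMap) h]; simp [hBu]
      set v : V := ∑ j, (a j * b.repr u j) • b j with hv
      have hBv : B v = 0 := by
        rw [hv, map_sum]
        refine Finset.sum_eq_zero fun j _ => ?_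
        rw [map_smul, h, smul_smul, mul_assoc, mul_comm (b.repr u j), hc, mul_zero, zero_smul]
      have h1 : inner ℂ v (Ω u) = inner ℂ v v := by
        conv_lhs => rw [← b.sum_repr u]
        nth_rewrite 3 [hv]
        rw [map_sum, inner_sum, inner_sum]
        refine Finset.sum_congr rfl fun j _ => ?_
        rw [map_smul, inner_smul_right, inner_smul_right]
        rcases mul_eq_zero.1 (hc j) with hj | hj
        · rw [ha j hj v hBv]; ring
        · rw [hj]; ring
      have hv0 : v = 0 := by
        rw [← inner_self_eq_zero (𝕜 := ℂ), ← h1]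
        exact hu' v hBv
      rw [b.mem_span_image]
      intro j hj
      have hj' := Finsupp.mem_support_iff.1 hj
      have := DFunLike.congr_fun (congrArg b.repr hv0) j
      rw [hv, b.repr_sum_self, map_zero] at this
      exact ⟨(mul_eq_zero.1 (hc j)).resolve_right hj', (mul_eq_zero.1 this).resolve_right hj'⟩

/-- Makes the eigenvalues with multiplicity independent of the eigenbasis, so that two families of
modes can be compared. -/
theorem map_eigenvalues_eq_roots_charpoly {ι W : Type*} [Fintype ι] [AddCommGroup W] [Module ℂ W]
    [FiniteDimensional ℂ W] (b : Module.Basis ι ℂ W) {f : W →ₗ[ℂ] W} {l : ι → ℂ}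
    (h : ∀ j, f (b j) = l j • b j) : Finset.univ.val.map l = f.charpoly.roots := by
  classical
  have : LinearMap.toMatrix b b f = Matrix.diagonal l := by
    ext i j
    rw [LinearMap.toMatrix_apply, h, map_smul, b.repr_self, Matrix.diagonal_apply]
    by_cases hij : i = j
    · simp [hij]
    · simp [hij]
  rw [← LinearMap.charpoly_toMatrix f b, this, Matrix.charpoly_diagonal,
    Polynomial.roots_prod _ _ (by
      rw [Finset.prod_ne_zero_iff]; exact fun j _ => Polynomial.X_sub_C_ne_zero _)]
  simp

/-- Pair with `u`: `ζ ‖u‖² = ⟨u, Ωu⟩ - iβ ⟨u, Bu⟩`, where both forms are real and the second is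
nonnegative. -/
theorem im_nonpos_of_dissipative {B Ω : V →L[ℂ] V}
    (hB0 : ∀ u, 0 ≤ (inner ℂ u (B u)).re ∧ (inner ℂ u (B u)).im = 0)
    (hΩ : ∀ u v, inner ℂ (Ω u) v = inner ℂ u (Ω v)) {β : ℝ} (hβ : 0 ≤ β) {ζ : ℂ} {u : V}
    (hu : u ≠ 0) (h : Ω u - (Complex.I * β) • B u = ζ • u) : ζ.im ≤ 0 ∧ |ζ.re| ≤ ‖Ω‖ := by
  have hΩr : (inner ℂ u (Ω u)).im = 0 := by
    have := congrArg Complex.im (inner_conj_symm u (Ω u))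
    rw [hΩ, Complex.conj_im] at this
    linarith
  have hu' : 0 < ‖u‖ ^ 2 := by have := norm_pos_iff.2 hu; positivity
  have h1 := congrArg (inner ℂ u) h
  rw [inner_sub_right, inner_smul_right, inner_smul_right, inner_self_eq_norm_sq_to_K] at h1
  have h2 : ζ * ((‖u‖ : ℂ) ^ 2) = ((‖u‖ ^ 2 : ℝ) : ℂ) * ζ := by push_cast; ring
  have hre := congrArg Complex.re h1
  have him := congrArg Complex.im h1
  simp only [Complex.coe_algebraMap, h2, Complex.re_ofReal_mul, Complex.im_ofReal_mul] at hre him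
  simp [hΩr, (hB0 u).2] at hre him
  constructor
  · have := mul_nonneg hβ (hB0 u).1
    by_contra hc
    rw [not_le] at hc
    have := mul_pos hu' hc
    linarith
  · have h3 : |(inner ℂ u (Ω u)).re| ≤ ‖Ω‖ * ‖u‖ ^ 2 := by
      refine (Complex.abs_re_le_norm _).trans ((norm_inner_le_norm _ _).trans ?_)
      have := mul_le_mul_of_nonneg_left (Ω.le_opNorm u) (norm_nonneg u)
      linarith
    rw [hre, abs_mul, abs_of_pos hu', mul_comm] at h3
    exact le_of_mul_le_mul_right h3 hu'

end Pencil

/-! ### Loss and frequency operators in block form -/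

section BlockOperators

variable {E : Type*} [NormedAddCommGroup E] [InnerProductSpace ℂ E] [FiniteDimensional ℂ E]

/-- The operator `R ⊕ 0`. -/
noncomputable def lossOp (R : E →L[ℂ] E) : WithLp 2 (E × E) →L[ℂ] WithLp 2 (E × E) :=
  LinearMap.toContinuousLinearMap
    { toFun := fun u => WithLp.toLp 2 (R u.fst, 0)
      map_add' := fun u v => WithLp.ofLp_injective 2 (Prod.ext (by simp) (by simp))
      map_smul' := fun c u => WithLp.ofLp_injective 2 (Prod.ext (by simp) (by simp)) }

/-- The operator with blocks `-2iΘ`, `-iΦ*`, `iΦ`, `0`. -/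
noncomputable def freqOp (Θ Φ : E →L[ℂ] E) : WithLp 2 (E × E) →L[ℂ] WithLp 2 (E × E) :=
  LinearMap.toContinuousLinearMap
    { toFun := fun u => WithLp.toLp 2
        ((-2 * Complex.I) • Θ u.fst + (-Complex.I) • Φ.adjoint u.snd, Complex.I • Φ u.fst)
      map_add' := fun u v => WithLp.ofLp_injective 2 (Prod.ext
        (by simp only [WithLp.add_fst, WithLp.add_snd, map_add, smul_add, WithLp.ofLp_add,
              Prod.fst_add]; abel)
        (by simp))
      map_smul' := fun c u => WithLp.ofLp_injective 2 (Prod.ext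
        (by simp [smul_comm c]) (by simp [smul_comm c])) }

@[simp] theorem lossOp_apply (R : E →L[ℂ] E) (u : WithLp 2 (E × E)) :
    lossOp R u = WithLp.toLp 2 (R u.fst, 0) := rfl

@[simp] theorem freqOp_apply (Θ Φ : E →L[ℂ] E) (u : WithLp 2 (E × E)) :
    freqOp Θ Φ u = WithLp.toLp 2
      ((-2 * Complex.I) • Θ u.fst + (-Complex.I) • Φ.adjoint u.snd, Complex.I • Φ u.fst) := rfl

theorem lossOp_symm {R : E →L[ℂ] E} (hR : ∀ x y, inner ℂ (R x) y = inner ℂ x (R y))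
    (u v : WithLp 2 (E × E)) : inner ℂ (lossOp R u) v = inner ℂ u (lossOp R v) := by
  simp [WithLp.prod_inner_apply, hR]

theorem freqOp_symm {Θ Φ : E →L[ℂ] E} (hΘ : ∀ x y, inner ℂ (Θ x) y = -inner ℂ x (Θ y))
    (u v : WithLp 2 (E × E)) : inner ℂ (freqOp Θ Φ u) v = inner ℂ u (freqOp Θ Φ v) := by
  simp only [freqOp_apply, WithLp.prod_inner_apply, inner_add_left, inner_add_right,
    inner_smul_left, inner_smul_right, hΘ, ContinuousLinearMap.adjoint_inner_left,
    ContinuousLinearMap.adjoint_inner_right, map_neg, map_mul, Complex.conj_I, map_ofNat, WithLp.fst, WithLp.snd]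
  ring

/-- The inclusion of the second summand. -/
noncomputable def secondInclusion (E : Type*) [NormedAddCommGroup E] [InnerProductSpace ℂ E] :
    E →ₗ[ℂ] WithLp 2 (E × E) where
  toFun x := WithLp.toLp 2 (0, x)
  map_add' x y := by rw [← WithLp.toLp_add]; simp
  map_smul' c x := by rw [← WithLp.toLp_smul]; simp

/-- The inclusion of the first summand. -/
noncomputable def firstInclusion (E : Type*) [NormedAddCommGroup E] [InnerProductSpace ℂ E] :
    E →ₗ[ℂ] WithLp 2 (E × E) where
  toFun x := WithLp.toLp 2 (x, 0)
  map_add' x y := by rw [← WithLp.toLp_add]; simp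
  map_smul' c x := by rw [← WithLp.toLp_smul]; simp

theorem finrank_range_lossOp (R : E →L[ℂ] E) :
    Module.finrank ℂ (LinearMap.range (lossOp R).toLinearMap) =
      Module.finrank ℂ (LinearMap.range R.toLinearMap) := by
  have hinj : Function.Injective (firstInclusion E) := fun x y h =>
    congrArg (fun u : WithLp 2 (E × E) => u.fst) h
  rw [(Submodule.equivMapOfInjective _ hinj _).finrank_eq]
  suffices h : LinearMap.range (lossOp R).toLinearMap =
      (LinearMap.range R.toLinearMap).map (firstInclusion E) by rw [h]
  ext u
  constructor
  · rintro ⟨v, rfl⟩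
    exact ⟨R v.fst, ⟨v.fst, rfl⟩, rfl⟩
  · rintro ⟨_, ⟨x, rfl⟩, rfl⟩
    exact ⟨WithLp.toLp 2 (x, 0), rfl⟩

/-- Let `u = (φ, ψ)` with `R φ = 0` be in the kernel. Testing against `(0, Φφ)` gives `Φφ = 0`, so
`φ = 0`; testing against `(x, 0)` with `R x = 0` then gives `ψ ⊥ Φ(ker R)`. As `Φ` is injective on
`ker R`, this orthogonal complement has dimension `dim E - dim ker R`. -/
theorem finrank_compressionKernel {R Θ Φ : E →L[ℂ] E}
    (hinj : ∀ x, R x = 0 → Φ x = 0 → x = 0) :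
    Module.finrank ℂ (compressionKernel (lossOp R) (freqOp Θ Φ)) =
      Module.finrank ℂ (LinearMap.range R.toLinearMap) := by
  set p : Submodule ℂ E := (LinearMap.ker R.toLinearMap).map Φ.toLinearMap with hp
  have hinc : Function.Injective (secondInclusion E) := fun x y h =>
    congrArg (fun u : WithLp 2 (E × E) => u.snd) h
  have hker : ∀ u : WithLp 2 (E × E), u ∈ LinearMap.ker (lossOp R).toLinearMap ↔ R u.fst = 0 := by
    intro u
    constructor
    · intro h
      exact congrArg (fun u : WithLp 2 (E × E) => u.fst) h
    · intro h
      change lossOp R u = 0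
      rw [lossOp_apply, h]; rfl
  have h1 : compressionKernel (lossOp R) (freqOp Θ Φ) = pᗮ.map (secondInclusion E) := by
    ext u
    constructor
    · rintro ⟨hu, hu'⟩
      have hu1 : R u.fst = 0 := (hker u).1 hu
      have hu2 : ∀ v : WithLp 2 (E × E), R v.fst = 0 → inner ℂ v (freqOp Θ Φ u) = 0 :=
        fun v hv => hu' v ((hker v).2 hv)
      have hΦ : Φ u.fst = 0 := by
        have := hu2 (WithLp.toLp 2 (0, Φ u.fst)) (by simp)
        simpa [WithLp.prod_inner_apply, inner_smul_right] using this
      have h0 : u.fst = 0 := hinj _ hu1 hΦ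
      refine ⟨u.snd, ?_, ?_⟩
      · rintro _ ⟨x, hx, rfl⟩
        have hx' : R x = 0 := hx
        have := hu2 (WithLp.toLp 2 (x, 0)) (by simpa using hx')
        simpa [WithLp.prod_inner_apply, inner_smul_right, h0,
          ContinuousLinearMap.adjoint_inner_right] using this
      · change WithLp.toLp 2 (0, u.snd) = u
        rw [← h0]; rfl
    · rintro ⟨x, hx, rfl⟩
      refine ⟨(hker _).2 (by simp [secondInclusion]), fun v hv => ?_⟩
      have hv' := (hker v).1 hv
      have := hx (Φ v.fst) ⟨v.fst, hv', rfl⟩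
      change inner ℂ v (freqOp Θ Φ (WithLp.toLp 2 (0, x))) = 0
      simp [WithLp.prod_inner_apply, inner_smul_right, ContinuousLinearMap.adjoint_inner_right,
        this]
  have h2 : Module.finrank ℂ p = Module.finrank ℂ (LinearMap.ker R.toLinearMap) := by
    have hi : Function.Injective (Φ.toLinearMap.domRestrict (LinearMap.ker R.toLinearMap)) := by
      rw [← LinearMap.ker_eq_bot, LinearMap.ker_eq_bot']
      intro x hx
      exact Subtype.ext (hinj _ x.2 hx)
    rw [← LinearMap.finrank_range_of_inj hi, LinearMap.range_domRestrict]
  rw [h1, ← (Submodule.equivMapOfInjective _ hinc _).finrank_eq]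
  have h3 := p.finrank_add_finrank_orthogonal
  have h4 := LinearMap.finrank_range_add_finrank_ker R.toLinearMap
  omega

/-- Norms on `E` are controlled by a pair of jointly injective operators. -/
theorem exists_norm_le_of_joint_injective {R Φ : E →L[ℂ] E}
    (hinj : ∀ x, R x = 0 → Φ x = 0 → x = 0) :
    ∃ K : ℝ, 0 < K ∧ ∀ x, ‖x‖ ≤ K * (‖Φ x‖ + ‖R x‖) := by
  obtain ⟨K, hK, h⟩ := LinearMap.exists_antilipschitzWith (Φ.prod R).toLinearMap (by
    rw [LinearMap.ker_eq_bot']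
    intro x hx
    have hx' : (Φ x, R x) = 0 := hx
    rw [Prod.mk_eq_zero] at hx'
    exact hinj x hx'.2 hx'.1)
  refine ⟨K, hK, fun x => ?_⟩
  have := h.le_mul_dist x 0
  simp only [dist_zero_right, map_zero] at this
  refine this.trans (mul_le_mul_of_nonneg_left ?_ K.2)
  change ‖(Φ x, R x)‖ ≤ _
  rw [Prod.norm_mk]
  exact max_le_add_of_nonneg (norm_nonneg _) (norm_nonneg _)

/-- The adjoint is injective on the range of `Φ`, since `‖Φx‖² = ⟨x, Φ*Φx⟩`. -/
theorem exists_norm_le_adjoint (Φ : E →L[ℂ] E) :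
    ∃ K : ℝ, 0 < K ∧ ∀ x, ‖Φ x‖ ≤ K * ‖Φ.adjoint (Φ x)‖ := by
  obtain ⟨K, hK, h⟩ := LinearMap.exists_antilipschitzWith
    (Φ.adjoint.toLinearMap.domRestrict (LinearMap.range Φ.toLinearMap)) (by
    rw [LinearMap.ker_eq_bot']
    rintro ⟨_, x, rfl⟩ hx
    have hx' : Φ.adjoint (Φ x) = 0 := hx
    have : inner ℂ (Φ x) (Φ x) = 0 := by
      rw [← ContinuousLinearMap.adjoint_inner_left, hx', inner_zero_left]
    exact Subtype.ext (inner_self_eq_zero.1 this))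
  refine ⟨K, hK, fun x => ?_⟩
  have := h.le_mul_dist ⟨Φ x, x, rfl⟩ 0
  rw [dist_zero_right, map_zero, dist_zero_right] at this
  exact this

end BlockOperators

/-! ### Low-loss modes tending to zero are overdamped -/

section LowQualityBound

variable {E : Type*} [NormedAddCommGroup E] [InnerProductSpace ℂ E] [FiniteDimensional ℂ E]

/-- Pair the rows with `φ` and `ψ`. The coupling terms `-i⟨Φφ, ψ⟩` and `i⟨ψ, Φφ⟩` are complex
conjugates, so they cancel in the difference of the real parts and in the sum of the imaginary
parts. The gyroscopic term is real by skewness. -/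
theorem re_im_block_eigenvalue {S Θ Φ : E →L[ℂ] E}
    (hΘ : ∀ x y, inner ℂ (Θ x) y = -inner ℂ x (Θ y)) {β : ℝ} {ζ : ℂ} {φ ψ : E}
    (h₁ : ζ • φ = (-2 * Complex.I) • Θ φ + (-Complex.I) • Φ.adjoint ψ -
      (Complex.I * β) • S.adjoint (S φ))
    (h₂ : ζ • ψ = Complex.I • Φ φ) :
    ζ.re * (‖φ‖ ^ 2 - ‖ψ‖ ^ 2) = (-2 * Complex.I * inner ℂ φ (Θ φ)).re ∧
      ζ.im * (‖φ‖ ^ 2 + ‖ψ‖ ^ 2) = -(β * ‖S φ‖ ^ 2) := by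
  have e1 := congrArg (inner ℂ φ) h₁
  have e2 := congrArg (inner ℂ ψ) h₂
  rw [inner_sub_right, inner_add_right, inner_smul_right, inner_smul_right, inner_smul_right,
    inner_smul_right, ContinuousLinearMap.adjoint_inner_right,
    ContinuousLinearMap.adjoint_inner_right, inner_self_eq_norm_sq_to_K,
    inner_self_eq_norm_sq_to_K] at e1
  rw [inner_smul_right, inner_smul_right, inner_self_eq_norm_sq_to_K,
    ← inner_conj_symm ψ (Φ φ)] at e2
  have hθ : (inner ℂ φ (Θ φ)).re = 0 := by
    have h1 := congrArg Complex.re (inner_conj_symm φ (Θ φ))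
    rw [hΘ, Complex.conj_re, Complex.neg_re] at h1
    linarith
  generalize inner ℂ (Φ φ) ψ = a at e1 e2
  generalize inner ℂ φ (Θ φ) = θ at e1 hθ
  simp only [Complex.coe_algebraMap, ← Complex.ofReal_pow] at e1 e2
  have r1 := congrArg Complex.re e1
  have i1 := congrArg Complex.im e1
  have r2 := congrArg Complex.re e2
  have i2 := congrArg Complex.im e2
  simp [hθ, -Complex.ofReal_pow] at r1 i1 r2 i2
  constructor
  · simp
    linarith
  · linarith

/-- Numerical core, with `f, g, r, a, s` the norms of `φ, ψ, S*Sφ, Φ*ψ, Sφ`, and `z = |ζ|`, `x = Re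
ζ`, `y = -Im ζ`. The first row gives `r = O(1/β)`, hence `f = O(1/β)` and `g ≥ 1/2`. So `a` is
bounded below, the first row forces `βr`, hence `βs`, to be bounded below, and `y = βs² ≥ c/β`,
while `|x| = O(f²) = O(1/β²)`. -/
theorem quality_arith {T P K₁ K₂ M C₀ : ℝ} (hT : 0 ≤ T) (hP : 0 ≤ P) (hK₁ : 0 < K₁) (hK₂ : 0 < K₂)
    (hM : 0 < M) (hC₀ : 0 ≤ C₀) : ∃ C b : ℝ, 0 < b ∧ ∀ β ≥ b, ∀ f g r a s z x y : ℝ,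
      0 ≤ f → 0 ≤ g → 0 ≤ r → 0 ≤ s → 0 ≤ z → f ^ 2 + g ^ 2 = 1 → z ≤ C₀ / β →
      β * r ≤ 2 * T * f + a + z * f → a ≤ β * r + 2 * T * f + z * f → a ≤ P * g →
      f ≤ K₁ * (z * g + r) → g ≤ K₂ * a → r ≤ M * s → y = β * s ^ 2 →
      |x| * |f ^ 2 - g ^ 2| ≤ 2 * T * f ^ 2 → 0 < y ∧ |x| ≤ 2 * (C / β) * y := by
  set C₁ := 2 * T + P + C₀ with hC₁
  set C₂ := K₁ * (C₀ + C₁) with hC₂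
  have hC₁0 : 0 ≤ C₁ := by positivity
  have hC₂0 : 0 ≤ C₂ := by positivity
  set c := 1 / (16 * K₂ ^ 2 * M ^ 2) with hc
  have hc0 : 0 < c := by positivity
  -- The first constant solves `2 (C/β)(c/β) = 4 T C₂² / β²`. The terms of the threshold ensure in
  -- turn `z ≤ C₀`, `f ≤ 1/2`, and `(2T + z) f ≤ 1/(4 K₂)`.
  refine ⟨2 * T * C₂ ^ 2 / c, 1 + 2 * C₂ + 4 * K₂ * ((2 * T + C₀) * C₂), by positivity, ?_⟩
  intro β hβ f g r a s z x y hf hg hr hs hz hfg hzC h1 h2 h3 h4 h5 h6 h7 h8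
  have hx1 : 0 ≤ 4 * K₂ * ((2 * T + C₀) * C₂) := by positivity
  have hβ1 : 1 ≤ β := by linarith
  have hβ0 : 0 < β := by linarith
  clear_value c C₂ C₁
  have hf1 : f ≤ 1 := (sq_le_one_iff₀ hf).1 (by linarith [sq_nonneg g])
  have hg1 : g ≤ 1 := (sq_le_one_iff₀ hg).1 (by linarith [sq_nonneg f])
  have hzC0 : z ≤ C₀ := hzC.trans (div_le_self hC₀ hβ1)
  have hr1 : r ≤ C₁ / β := by
    rw [le_div_iff₀ hβ0]
    have q1 : 2 * T * f ≤ 2 * T := mul_le_of_le_one_right (by positivity) hf1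
    have q2 : z * f ≤ C₀ := (mul_le_of_le_one_right hz hf1).trans hzC0
    have q3 : P * g ≤ P := mul_le_of_le_one_right hP hg1
    linarith
  have hf2 : f ≤ C₂ / β := by
    have q1 : z * g ≤ C₀ / β := (mul_le_of_le_one_right hz hg1).trans hzC
    calc f ≤ K₁ * (z * g + r) := h4
      _ ≤ K₁ * (C₀ / β + C₁ / β) := by gcongr
      _ = C₂ / β := by rw [hC₂]; ring
  have hf3 : f ≤ 1 / 2 := by
    refine hf2.trans ?_
    rw [div_le_iff₀ hβ0]; linarith
  have hfs : f ^ 2 ≤ 1 / 4 := (pow_le_pow_left₀ hf hf3 2).trans (by norm_num)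
  have hg2 : 1 / 2 ≤ g := (pow_le_pow_iff_left₀ (by norm_num) hg two_ne_zero).1 (by
    norm_num; linarith)
  have habs : 1 / 2 ≤ |f ^ 2 - g ^ 2| := by
    rw [abs_sub_comm]
    refine le_trans ?_ (le_abs_self _)
    linarith
  have hx : |x| ≤ 4 * T * C₂ ^ 2 / β ^ 2 := by
    have q1 : |x| * (1 / 2) ≤ 2 * T * f ^ 2 :=
      (mul_le_mul_of_nonneg_left habs (abs_nonneg x)).trans h8
    have q2 : f ^ 2 ≤ (C₂ / β) ^ 2 := by gcongr
    have q3 : 2 * T * f ^ 2 ≤ 2 * T * (C₂ / β) ^ 2 := by gcongr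
    rw [div_pow] at q3
    have e : 4 * T * C₂ ^ 2 / β ^ 2 = 2 * (2 * T * (C₂ ^ 2 / β ^ 2)) := by ring
    rw [e]; linarith
  have ha : 1 / (2 * K₂) ≤ a := by
    rw [div_le_iff₀ (by positivity)]; linarith
  have hsm : 2 * T * f + z * f ≤ 1 / (4 * K₂) := by
    have q1 : 2 * T * f + z * f ≤ (2 * T + C₀) * (C₂ / β) := by
      rw [← add_mul]; gcongr
    refine q1.trans ?_
    rw [le_div_iff₀ (by positivity), mul_div_assoc', div_mul_eq_mul_div, div_le_iff₀ hβ0]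
    linarith
  have hβr : 1 / (4 * K₂) ≤ β * r := by
    have e : 1 / (2 * K₂) = 1 / (4 * K₂) + 1 / (4 * K₂) := by field_simp; norm_num
    linarith
  have hs1 : 1 / (4 * K₂ * M * β) ≤ s := by
    have q : β * r ≤ β * (M * s) := by gcongr
    have q2 := hβr.trans q
    rw [div_le_iff₀ (by positivity)] at q2 ⊢
    linarith
  have hy : c / β ≤ y := by
    rw [h7]
    have q : (1 / (4 * K₂ * M * β)) ^ 2 ≤ s ^ 2 := by gcongr
    calc c / β = β * (1 / (4 * K₂ * M * β)) ^ 2 := by rw [hc]; field_simp; norm_num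
      _ ≤ β * s ^ 2 := by gcongr
  refine ⟨(by positivity : 0 < c / β).trans_le hy, hx.trans ?_⟩
  calc 4 * T * C₂ ^ 2 / β ^ 2 = 2 * (2 * T * C₂ ^ 2 / c / β) * (c / β) := by field_simp; ring
    _ ≤ 2 * (2 * T * C₂ ^ 2 / c / β) * y := by gcongr

/-- Eigenvalues of size `O(1 / β)` are overdamped: either they vanish or their real part is
`O(1 / β)` relative to their imaginary part. -/
theorem exists_overdamped_bound {S Θ Φ : E →L[ℂ] E}
    (hΘ : ∀ x y, inner ℂ (Θ x) y = -inner ℂ x (Θ y))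
    (hinj : ∀ x, (S.adjoint ∘L S) x = 0 → Φ x = 0 → x = 0) {C₀ : ℝ} (hC₀ : 0 ≤ C₀) :
    ∃ C : ℝ, ∀ᶠ β : ℝ in atTop, ∀ (ζ : ℂ) (u : WithLp 2 (E × E)), u ≠ 0 →
      freqOp Θ Φ u - (Complex.I * β) • lossOp (S.adjoint ∘L S) u = ζ • u → ‖ζ‖ ≤ C₀ / β →
      ζ = 0 ∨ ζ.im ≠ 0 ∧ |ζ.re| ≤ 2 * (C / β) * -ζ.im := by
  obtain ⟨K₁, hK₁, H₁⟩ := exists_norm_le_of_joint_injective hinj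
  obtain ⟨K₂, hK₂, H₂⟩ := exists_norm_le_adjoint Φ
  obtain ⟨C, b, hb, H⟩ := quality_arith (norm_nonneg Θ) (norm_nonneg Φ.adjoint) hK₁ hK₂
    (by positivity : 0 < ‖S.adjoint‖ + 1) hC₀
  refine ⟨C, eventually_atTop.2 ⟨b, fun β hβ ζ u hu h hζ => ?_⟩⟩
  by_cases hζ0 : ζ = 0
  · exact Or.inl hζ0
  right
  wlog hu1 : ‖u‖ = 1 generalizing u
  · refine this ((‖u‖⁻¹ : ℂ) • u) ?_ ?_ ?_
    · exact smul_ne_zero (inv_ne_zero (by simpa using hu)) hu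
    · rw [map_smul, map_smul, smul_comm _ _ (lossOp _ u), ← smul_sub, h, smul_comm]
    · rw [norm_smul, norm_inv, Complex.norm_real, norm_norm,
        inv_mul_cancel₀ (norm_ne_zero_iff.2 hu)]
  have hβ0 : 0 < β := hb.trans_le hβ
  have h₁ : ζ • u.fst = (-2 * Complex.I) • Θ u.fst + (-Complex.I) • Φ.adjoint u.snd -
      (Complex.I * β) • S.adjoint (S u.fst) :=
    (congrArg (fun u : WithLp 2 (E × E) => u.fst) h).symm
  have h₂ : ζ • u.snd = Complex.I • Φ u.fst := by
    have := (congrArg (fun u : WithLp 2 (E × E) => u.snd) h).symm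
    simpa using this
  obtain ⟨hre, him⟩ := re_im_block_eigenvalue hΘ h₁ h₂
  have hn : ‖u.fst‖ ^ 2 + ‖u.snd‖ ^ 2 = 1 := by
    have := WithLp.prod_norm_sq_eq_of_L2 u
    rw [hu1] at this
    linarith
  rw [hn, mul_one] at him
  have n1 : ‖(Complex.I * β) • S.adjoint (S u.fst)‖ = β * ‖S.adjoint (S u.fst)‖ := by
    simp [norm_smul, abs_of_pos hβ0]
  have n2 : ‖(-2 * Complex.I) • Θ u.fst‖ ≤ 2 * ‖Θ‖ * ‖u.fst‖ := by
    have := Θ.le_opNorm u.fst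
    simp only [norm_smul, norm_mul, norm_neg, Complex.norm_I, Complex.norm_ofNat, mul_one]
    linarith
  have n3 : ‖(-Complex.I) • Φ.adjoint u.snd‖ = ‖Φ.adjoint u.snd‖ := by simp [norm_smul]
  have n4 : ‖ζ • u.fst‖ = ‖ζ‖ * ‖u.fst‖ := norm_smul _ _
  have n5 : ‖Φ u.fst‖ = ‖ζ‖ * ‖u.snd‖ := by
    rw [← norm_smul, h₂, norm_smul, Complex.norm_I, one_mul]
  have key := H β hβ ‖u.fst‖ ‖u.snd‖ ‖S.adjoint (S u.fst)‖ ‖Φ.adjoint u.snd‖ ‖S u.fst‖ ‖ζ‖ ζ.re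
    (-ζ.im) (norm_nonneg _) (norm_nonneg _) (norm_nonneg _) (norm_nonneg _) (norm_nonneg _) hn hζ
    (by
      have e : (Complex.I * β) • S.adjoint (S u.fst) = (-2 * Complex.I) • Θ u.fst +
        (-Complex.I) • Φ.adjoint u.snd - ζ • u.fst := by rw [h₁]; abel
      have := norm_sub_le ((-2 * Complex.I) • Θ u.fst + (-Complex.I) • Φ.adjoint u.snd) (ζ • u.fst)
      have := norm_add_le ((-2 * Complex.I) • Θ u.fst) ((-Complex.I) • Φ.adjoint u.snd)
      rw [← e] at *
      linarith)
    (by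
      have e : (-Complex.I) • Φ.adjoint u.snd = ζ • u.fst + (Complex.I * β) • S.adjoint (S u.fst) -
        (-2 * Complex.I) • Θ u.fst := by rw [h₁]; abel
      have := norm_sub_le (ζ • u.fst + (Complex.I * β) • S.adjoint (S u.fst))
        ((-2 * Complex.I) • Θ u.fst)
      have := norm_add_le (ζ • u.fst) ((Complex.I * β) • S.adjoint (S u.fst))
      rw [← e] at *
      linarith)
    (Φ.adjoint.le_opNorm _)
    (by
      have := H₁ u.fst
      rwa [n5] at this)
    (by
      -- As `ζ ≠ 0`, the second row puts `ψ` in the range of `Φ`, where the adjoint is bounded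
      -- below.
      have e : u.snd = Φ ((ζ⁻¹ * Complex.I) • u.fst) := by
        rw [map_smul, mul_smul, ← h₂, inv_smul_smul₀ hζ0]
      have := H₂ ((ζ⁻¹ * Complex.I) • u.fst)
      rwa [← e] at this)
    (by
      have := S.adjoint.le_opNorm (S u.fst)
      have := norm_nonneg (S u.fst)
      linarith)
    (by linarith)
    (by
      rw [← abs_mul, hre]
      refine (Complex.abs_re_le_norm _).trans ?_
      have q1 := norm_inner_le_norm (𝕜 := ℂ) u.fst (Θ u.fst)
      have q2 := mul_le_mul_of_nonneg_left (Θ.le_opNorm u.fst) (norm_nonneg u.fst)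
      simp only [norm_mul, norm_neg, Complex.norm_I, Complex.norm_ofNat, mul_one]
      linarith)
  exact ⟨fun h0 => by rw [h0] at key; simp at key, key.2⟩

end LowQualityBound

/-! ### Real matrices acting on complex space -/

section RealMatrices

variable {n : Type*} [Fintype n] [DecidableEq n]

/-- The operator on `ℂ^n` given by a real matrix. -/
noncomputable def realMatrixOp (M : Matrix n n ℝ) : EuclideanSpace ℂ n →L[ℂ] EuclideanSpace ℂ n :=
  Matrix.toEuclideanCLM (𝕜 := ℂ) (M.map Complex.ofReal)

theorem realMatrixOp_mul (M M' : Matrix n n ℝ) :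
    realMatrixOp (M * M') = realMatrixOp M ∘L realMatrixOp M' := by
  rw [realMatrixOp, show (M * M').map Complex.ofReal =
    M.map Complex.ofReal * M'.map Complex.ofReal from Matrix.map_mul (f := Complex.ofRealHom),
    map_mul]
  rfl

theorem adjoint_realMatrixOp (M : Matrix n n ℝ) :
    (realMatrixOp M).adjoint = realMatrixOp M.transpose := by
  rw [← ContinuousLinearMap.star_eq_adjoint, realMatrixOp, realMatrixOp, ← map_star]
  congr 1
  ext i j
  simp [Matrix.star_apply]

theorem realMatrixOp_neg (M : Matrix n n ℝ) : realMatrixOp (-M) = -realMatrixOp M := by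
  rw [realMatrixOp, realMatrixOp, ← map_neg]
  congr 1
  ext i j
  simp

theorem inner_realMatrixOp_of_skew {M : Matrix n n ℝ} (h : M.transpose = -M)
    (x y : EuclideanSpace ℂ n) :
    inner ℂ (realMatrixOp M x) y = -inner ℂ x (realMatrixOp M y) := by
  rw [← ContinuousLinearMap.adjoint_inner_right, adjoint_realMatrixOp, h, realMatrixOp_neg,
    neg_apply, inner_neg_right]

theorem realMatrixOp_apply_eq_zero_iff (M : Matrix n n ℝ) (x : EuclideanSpace ℂ n) :
    realMatrixOp M x = 0 ↔
      M.mulVec (fun i => (x i).re) = 0 ∧ M.mulVec (fun i => (x i).im) = 0 := by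
  have h : ∀ i, (realMatrixOp M x) i = ∑ j, (M i j : ℂ) * x j := fun i => by
    rw [realMatrixOp, Matrix.ofLp_toEuclideanCLM]; simp [Matrix.mulVec, dotProduct]
  constructor
  · intro hx
    refine ⟨funext fun i => ?_, funext fun i => ?_⟩
    · have := congrArg Complex.re ((h i).symm.trans (congrFun (congrArg WithLp.ofLp hx) i))
      simpa [Matrix.mulVec, dotProduct] using this
    · have := congrArg Complex.im ((h i).symm.trans (congrFun (congrArg WithLp.ofLp hx) i))
      simpa [Matrix.mulVec, dotProduct] using this
  · rintro ⟨h1, h2⟩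
    ext i
    rw [h]
    have e1 := congrFun h1 i
    have e2 := congrFun h2 i
    simp only [Matrix.mulVec, dotProduct, Pi.zero_apply] at e1 e2
    apply Complex.ext <;> simp [e1, e2]

/-- The rank normal form over the reals remains one over the complex numbers. -/
theorem Matrix.rank_map_ofReal (M : Matrix n n ℝ) : (M.map Complex.ofReal).rank = M.rank := by
  obtain ⟨V, U, e, hV, hU, h⟩ := Matrix.exists_rank_normal_form M
  have hmul : ∀ X Y : Matrix n n ℝ, (X * Y).map Complex.ofReal =
      X.map Complex.ofReal * Y.map Complex.ofReal :=
    fun X Y => Matrix.map_mul (f := Complex.ofRealHom)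
  have hunit : ∀ X : Matrix n n ℝ, IsUnit X → IsUnit (X.map Complex.ofReal).det := fun X hX => by
    rw [← Matrix.isUnit_iff_isUnit_det]
    exact hX.map (Complex.ofRealHom.mapMatrix (m := n))
  have hM := congrArg (fun X => X.map Complex.ofReal) h
  simp only [hmul] at hM
  have r1 : (V.map Complex.ofReal * M.map Complex.ofReal * U.map Complex.ofReal).rank =
      (M.map Complex.ofReal).rank := by
    rw [Matrix.rank_mul_eq_left_of_isUnit_det _ _ (hunit U hU),
      Matrix.rank_mul_eq_right_of_isUnit_det _ _ (hunit V hV)]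
  rw [← r1, hM]
  clear hM h r1 hV hU
  generalize M.rank = r at e
  have hd : ((Matrix.fromBlocks (1 : Matrix (Fin r) (Fin r) ℝ) 0 0
      (0 : Matrix (Fin (Fintype.card n - r)) (Fin (Fintype.card n - r)) ℝ)).submatrix e e).map
        Complex.ofReal = (Matrix.diagonal (Sum.elim (fun _ : Fin r => (1 : ℂ))
          (fun _ : Fin (Fintype.card n - r) => 0))).submatrix e e := by
    ext i j
    rcases hi : e i with a | a <;> rcases hj : e j with c | c <;>
      simp [Matrix.map_apply, Matrix.submatrix_apply, hi, hj, Matrix.diagonal_apply,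
        Matrix.one_apply, apply_ite Complex.ofReal]
  rw [hd, Matrix.rank_submatrix _ e e, Matrix.rank_diagonal]
  rw [Fintype.card_subtype]
  rw [Finset.card_filter, Fintype.sum_sum_type]
  simp

theorem finrank_range_realMatrixOp (M : Matrix n n ℝ) :
    Module.finrank ℂ (LinearMap.range (realMatrixOp M).toLinearMap) = M.rank := by
  rw [← Matrix.rank_map_ofReal, Matrix.rank_eq_finrank_range_toLin _
    (EuclideanSpace.basisFun n ℂ).toBasis (EuclideanSpace.basisFun n ℂ).toBasis]
  congr 1

end RealMatrices

/-! ### The system operator as a block operator -/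

namespace LagrangianSystem

variable {N : ℕ} (S : LagrangianSystem N)

theorem transpose_sqrt (M : Matrix (Fin N) (Fin N) ℝ) :
    (CFC.sqrt M).transpose = CFC.sqrt M := by
  have h : star (CFC.sqrt M) = CFC.sqrt M := (CFC.sqrt_nonneg M).isSelfAdjoint
  rwa [Matrix.star_eq_conjTranspose, Matrix.conjTranspose_eq_transpose_of_trivial] at h

theorem isUnit_Kp : IsUnit S.Kp := by
  have h : CFC.sqrt S.α * CFC.sqrt S.α = S.α :=
    CFC.sqrt_mul_sqrt_self _ S.α_posDef.posSemidef.nonneg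
  have h2 : IsUnit (CFC.sqrt S.α * CFC.sqrt S.α) := by
    rw [h]; exact S.α_posDef.isUnit
  rw [Kp, Matrix.isUnit_nonsing_inv_iff]
  exact isUnit_of_mul_isUnit_left h2

theorem Kp_transpose : S.Kp.transpose = S.Kp := by
  rw [Kp, Matrix.transpose_nonsing_inv, transpose_sqrt]

theorem sqrt_R_mul_self : (CFC.sqrt S.R).transpose * CFC.sqrt S.R = S.R := by
  rw [transpose_sqrt, CFC.sqrt_mul_sqrt_self _ S.R_posSemidef.nonneg]

theorem Kq_mul_self : S.Kq * S.Kq = S.η :=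
  CFC.sqrt_mul_sqrt_self _ S.η_posSemidef.nonneg

/-- A square root of the dissipation operator. -/
noncomputable def lossRoot : EuclideanSpace ℂ (Fin N) →L[ℂ] EuclideanSpace ℂ (Fin N) :=
  realMatrixOp (CFC.sqrt S.R * S.Kp.transpose)

/-- The gyroscopic operator. -/
noncomputable def gyro : EuclideanSpace ℂ (Fin N) →L[ℂ] EuclideanSpace ℂ (Fin N) :=
  realMatrixOp (S.Kp * S.θ * S.Kp.transpose)

/-- The stiffness operator. -/
noncomputable def stiff : EuclideanSpace ℂ (Fin N) →L[ℂ] EuclideanSpace ℂ (Fin N) :=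
  realMatrixOp S.Phi

theorem adjoint_lossRoot_comp : S.lossRoot.adjoint ∘L S.lossRoot =
    realMatrixOp (S.Kp * S.R * S.Kp.transpose) := by
  rw [lossRoot, adjoint_realMatrixOp, ← realMatrixOp_mul]
  congr 1
  conv_rhs => rw [← S.sqrt_R_mul_self]
  simp only [Matrix.transpose_mul, Matrix.transpose_transpose, Matrix.mul_assoc]

theorem finrank_range_lossRoot :
    Module.finrank ℂ (LinearMap.range (S.lossRoot.adjoint ∘L S.lossRoot).toLinearMap) =
      S.lossRank := by
  have h := (Matrix.isUnit_iff_isUnit_det _).1 S.isUnit_Kp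
  rw [adjoint_lossRoot_comp, finrank_range_realMatrixOp,
    Matrix.rank_mul_eq_left_of_isUnit_det _ _ (by rwa [Matrix.det_transpose]),
    Matrix.rank_mul_eq_right_of_isUnit_det _ _ h, lossRank]

theorem inner_gyro (x y : EuclideanSpace ℂ (Fin N)) :
    inner ℂ (S.gyro x) y = -inner ℂ x (S.gyro y) := by
  refine inner_realMatrixOp_of_skew ?_ x y
  simp [Matrix.transpose_mul, S.θ_skew, Matrix.mul_assoc]

/-- The substitution `a ↦ K_p a` and `η = K_q²` turn the two kernels into `Ker R` and `Ker η`; real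
and imaginary parts are treated separately. -/
theorem eq_zero_of_loss_of_stiff
    (h : LinearMap.ker S.R.mulVecLin ⊓ LinearMap.ker S.η.mulVecLin = ⊥)
    (x : EuclideanSpace ℂ (Fin N)) (h₁ : (S.lossRoot.adjoint ∘L S.lossRoot) x = 0)
    (h₂ : S.stiff x = 0) : x = 0 := by
  have hKp : Function.Injective S.Kp.mulVec := Matrix.mulVec_injective_iff_isUnit.2 S.isUnit_Kp
  have key : ∀ a : Fin N → ℝ, (S.Kp * S.R * S.Kp.transpose).mulVec a = 0 →
      S.Phi.mulVec a = 0 → a = 0 := fun a ha hb => by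
    rw [Kp_transpose, Matrix.mul_assoc, ← Matrix.mulVec_mulVec] at ha
    have ha' : (S.R * S.Kp).mulVec a = 0 := hKp (by rw [ha, Matrix.mulVec_zero])
    rw [← Matrix.mulVec_mulVec] at ha'
    rw [Phi, Kp_transpose, ← Matrix.mulVec_mulVec] at hb
    have hmem : S.Kp.mulVec a ∈ LinearMap.ker S.R.mulVecLin ⊓ LinearMap.ker S.η.mulVecLin := by
      refine ⟨ha', ?_⟩
      change S.η.mulVec (S.Kp.mulVec a) = 0
      rw [← S.Kq_mul_self, ← Matrix.mulVec_mulVec, hb, Matrix.mulVec_zero]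
    rw [h, Submodule.mem_bot] at hmem
    exact hKp (by rw [hmem, Matrix.mulVec_zero])
  rw [adjoint_lossRoot_comp, realMatrixOp_apply_eq_zero_iff] at h₁
  rw [stiff, realMatrixOp_apply_eq_zero_iff] at h₂
  ext i
  exact Complex.ext (congrFun (key _ h₁.1 h₂.1) i) (congrFun (key _ h₁.2 h₂.2) i)

/-- The identification of `ℂ^{2N}` with `ℂ^N ⊕ ℂ^N`. -/
noncomputable def splitEquiv (N : ℕ) : (Fin N ⊕ Fin N → ℂ) ≃ₗ[ℂ]
    WithLp 2 (EuclideanSpace ℂ (Fin N) × EuclideanSpace ℂ (Fin N)) where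
  toFun w := WithLp.toLp 2 (WithLp.toLp 2 (w ∘ Sum.inl), WithLp.toLp 2 (w ∘ Sum.inr))
  invFun u := Sum.elim (fun i => u.fst i) fun i => u.snd i
  map_add' _ _ := WithLp.ofLp_injective 2 (Prod.ext (by ext i; simp) (by ext i; simp))
  map_smul' _ _ := WithLp.ofLp_injective 2 (Prod.ext (by ext i; simp) (by ext i; simp))
  left_inv w := by ext (i | i) <;> simp
  right_inv u := WithLp.ofLp_injective 2 (Prod.ext (by ext i; simp) (by ext i; simp))

theorem splitEquiv_apply (w : Fin N ⊕ Fin N → ℂ) :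
    splitEquiv N w = WithLp.toLp 2 (WithLp.toLp 2 (w ∘ Sum.inl), WithLp.toLp 2 (w ∘ Sum.inr)) :=
  rfl

theorem splitEquiv_mulVec (β : ℝ) (w : Fin N ⊕ Fin N → ℂ) :
    splitEquiv N ((S.A β).mulVec w) = freqOp S.gyro S.stiff (splitEquiv N w) -
      (Complex.I * β) • lossOp (S.lossRoot.adjoint ∘L S.lossRoot) (splitEquiv N w) := by
  rw [adjoint_lossRoot_comp, freqOp_apply, lossOp_apply, stiff, adjoint_realMatrixOp, gyro]
  have hw : w = Sum.elim (w ∘ Sum.inl) (w ∘ Sum.inr) := (Sum.elim_comp_inl_inr w).symm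
  have hA : (S.A β).mulVec w = Sum.elim
      ((-2 * Complex.I) • ((S.Kp * S.θ * S.Kp.transpose).map Complex.ofReal).mulVec (w ∘ Sum.inl) +
        (-Complex.I) • (S.Phi.transpose.map Complex.ofReal).mulVec (w ∘ Sum.inr) -
        (Complex.I * β) •
          ((S.Kp * S.R * S.Kp.transpose).map Complex.ofReal).mulVec (w ∘ Sum.inl))
      (Complex.I • (S.Phi.map Complex.ofReal).mulVec (w ∘ Sum.inl)) := by
    rw [A, Omega, B, Matrix.sub_mulVec, Matrix.smul_mulVec, Matrix.fromBlocks_mulVec,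
      Matrix.fromBlocks_mulVec]
    simp only [Matrix.smul_mulVec, Matrix.zero_mulVec, add_zero]
    ext (i | i) <;> simp
  rw [hA]
  refine WithLp.ofLp_injective 2 (Prod.ext ?_ ?_)
  · rfl
  · ext i
    simp [splitEquiv_apply, realMatrixOp]

end LagrangianSystem

/-! ### Construction of the modes from the pencil -/

section Modes

theorem exists_equiv_iff {α γ : Type*} [Fintype α] [Fintype γ] (p : α → Prop) (q : γ → Prop)
    [DecidablePred p] [DecidablePred q] (h : Fintype.card α = Fintype.card γ)
    (hpq : Fintype.card {x // p x} = Fintype.card {y // q y}) :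
    ∃ e : α ≃ γ, ∀ x, p x ↔ q (e x) := by
  classical
  let e₀ := Fintype.equivOfCardEq h
  have hc : Fintype.card {x // p x} = Fintype.card {x // q (e₀ x)} := by
    rw [hpq]
    exact (Fintype.card_congr (e₀.subtypeEquiv fun x => Iff.rfl)).symm
  let s := Fintype.equivOfCardEq hc
  refine ⟨s.extendSubtype.trans e₀, fun x => ⟨fun hx => s.extendSubtype_mem x hx, fun hx => ?_⟩⟩
  by_contra hx'
  exact s.extendSubtype_not_mem x hx' hx

variable {V : Type*} [NormedAddCommGroup V] [InnerProductSpace ℂ V] [FiniteDimensional ℂ V]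

theorem tendsto_I_mul_inv : Tendsto (fun β : ℝ => Complex.I * (β : ℂ)⁻¹) atTop (𝓝 0) := by
  have h : Tendsto (fun β : ℝ => ((β⁻¹ : ℝ) : ℂ)) atTop (𝓝 0) :=
    tendsto_ofReal_zero.comp tendsto_inv_atTop_zero
  simpa using h.const_mul Complex.I

theorem AnalyticAt.comp_I_mul {F : Type*} [NormedAddCommGroup F] [NormedSpace ℂ F] {f : ℂ → F}
    (hf : AnalyticAt ℂ f 0) : AnalyticAt ℂ (fun z => f (Complex.I * z)) 0 :=
  AnalyticAt.fun_comp (g := f) (by simpa using hf) (analyticAt_const.mul analyticAt_id)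

/-- In the variable `z = β⁻¹` the function is `z⁻¹ · (-i l(iz))`, of order `-1`. -/
theorem hasPoleAtInfinity_of_ne_zero {l : ℂ → ℂ} (hl : AnalyticAt ℂ l 0) (h0 : l 0 ≠ 0) :
    HasPoleAtInfinity (fun β : ℝ => -(Complex.I * β) * l (Complex.I * (β : ℂ)⁻¹)) := by
  have han : AnalyticAt ℂ (fun z => -Complex.I * l (Complex.I * z)) 0 :=
    analyticAt_const.mul hl.comp_I_mul
  have hmer : MeromorphicAt (fun z => z⁻¹ * (-Complex.I * l (Complex.I * z))) 0 :=
    (MeromorphicAt.id 0).inv.mul han.meromorphicAt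
  refine ⟨_, hmer, ?_, Eventually.of_forall fun β => ?_⟩
  · have : meromorphicOrderAt (fun z => z⁻¹ * (-Complex.I * l (Complex.I * z))) 0 = (-1 : ℤ) := by
      rw [meromorphicOrderAt_eq_int_iff hmer]
      refine ⟨_, han, by simpa using h0, Eventually.of_forall fun z => ?_⟩
      simp
    rw [this]
    exact_mod_cast (by norm_num : (-1 : ℤ) < 0)
  · simp only [inv_inv]; ring

/-- Writing `l(z) = z · dslope l 0 z`, the prefactor `-iβ` cancels the factor `z = i/β`. -/
theorem analyticAtInfinity_of_eq_zero {l : ℂ → ℂ} (hl : AnalyticAt ℂ l 0) (h0 : l 0 = 0) :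
    AnalyticAtInfinity (fun β : ℝ => -(Complex.I * β) * l (Complex.I * (β : ℂ)⁻¹)) ∧
      Tendsto (fun β : ℝ => -(Complex.I * β) * l (Complex.I * (β : ℂ)⁻¹)) atTop
        (𝓝 (deriv l 0)) := by
  have hd : AnalyticAt ℂ (dslope l 0) 0 := by
    obtain ⟨p, hp⟩ := hl
    exact ⟨_, hp.has_fpower_series_dslope_fslope⟩
  have heq : ∀ᶠ β : ℝ in atTop, -(Complex.I * β) * l (Complex.I * (β : ℂ)⁻¹) =
      dslope l 0 (Complex.I * (β : ℂ)⁻¹) := by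
    filter_upwards [eventually_gt_atTop 0] with β hβ
    have hβ' : (β : ℂ) ≠ 0 := Complex.ofReal_ne_zero.2 hβ.ne'
    have h1 := sub_smul_dslope l 0 (Complex.I * (β : ℂ)⁻¹)
    rw [h0, sub_zero, sub_zero] at h1
    rw [← h1, smul_eq_mul]
    have : -(Complex.I * (β : ℂ)) * (Complex.I * (β : ℂ)⁻¹ *
        dslope l 0 (Complex.I * (β : ℂ)⁻¹)) = -(Complex.I * Complex.I) * ((β : ℂ) * (β : ℂ)⁻¹) *
        dslope l 0 (Complex.I * (β : ℂ)⁻¹) := by ring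
    rw [this, Complex.I_mul_I, mul_inv_cancel₀ hβ']
    ring
  refine ⟨⟨_, hd.comp_I_mul, heq⟩, ?_⟩
  have := hd.continuousAt.tendsto.comp tendsto_I_mul_inv
  rw [dslope_same] at this
  exact this.congr' (heq.mono fun β h => h.symm)

/-- Existence of the modes of `Ω - iβB` in the high-loss regime, together with the limits of the
low-loss eigenvalues. -/
theorem exists_modes {B Ω : V →L[ℂ] V} (hB : ∀ u v, inner ℂ (B u) v = inner ℂ u (B v))
    (hΩ : ∀ u v, inner ℂ (Ω u) v = inner ℂ u (Ω v)) {n r : ℕ} (hn : Module.finrank ℂ V = n)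
    (hr : Module.finrank ℂ (LinearMap.range B.toLinearMap) = r) :
    ∃ (ζ : Fin n → ℝ → ℂ) (w : Fin n → ℝ → V) (a : Fin n → ℝ),
      (∀ᶠ β : ℝ in atTop, ∀ j, Ω (w j β) - (Complex.I * β) • B (w j β) = ζ j β • w j β) ∧
      (∀ᶠ β : ℝ in atTop, LinearIndependent ℂ (fun j => w j β)) ∧
      (∀ j, AnalyticAtInfinity (w j)) ∧
      (∀ j : Fin n, (j : ℕ) < r → HasPoleAtInfinity (ζ j)) ∧
      (∀ j : Fin n, r ≤ (j : ℕ) → AnalyticAtInfinity (ζ j) ∧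
        Tendsto (ζ j) atTop (𝓝 ((a j : ℝ) : ℂ))) ∧
      Fintype.card {j : Fin n // r ≤ (j : ℕ) ∧ a j = 0} =
        Module.finrank ℂ (compressionKernel B Ω) := by
  classical
  obtain ⟨ι, _, b, e, l, he, hl, heb, h⟩ := exists_analytic_eigenbasis_pencil hB hΩ
  have hBb : ∀ j, B (b j) = l j 0 • b j := fun j => by
    have := h.self_of_nhds j
    simpa [heb] using this
  have hcard : Fintype.card ι = n := by rw [← hn, Module.finrank_eq_card_basis b]
  have hker := card_eq_zero_eigenvalues b (f := B.toLinearMap) hBb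
  have hrk := LinearMap.finrank_range_add_finrank_ker B.toLinearMap
  have hrn : r ≤ n := by omega
  obtain ⟨σ, hσ⟩ := exists_equiv_iff (fun j : Fin n => r ≤ (j : ℕ)) (fun i => l i 0 = 0)
    (by rw [hcard, Fintype.card_fin]) (by
      rw [hker]
      have : Fintype.card {j : Fin n // r ≤ (j : ℕ)} = n - r := by
        have h1 := Fintype.card_subtype_compl (fun j : Fin n => (j : ℕ) < r)
        simp only [not_lt] at h1
        rw [h1, Fintype.card_fin]
        congr 1
        rw [Fintype.card_subtype, Fin.card_filter_val_lt, min_eq_right hrn]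
      omega)
  have hfirst : ∀ i, l i 0 = 0 → ∀ v, B v = 0 →
      inner ℂ v (Ω (b i)) = deriv (l i) 0 * inner ℂ v (b i) := fun i hi v hv => by
    have := inner_pencil_first_order hB (he i) (hl i) (h.mono fun z hz => hz i) hi hv
    rwa [heb] at this
  -- The derivative is the Rayleigh quotient of the symmetric `Ω` at `b i`.
  have hreal : ∀ i, l i 0 = 0 → ((deriv (l i) 0).re : ℂ) = deriv (l i) 0 := fun i hi => by
    have h1 := hfirst i hi (b i) (by rw [hBb, hi, zero_smul])
    have h2 := congrArg (starRingEnd ℂ) h1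
    rw [inner_conj_symm, hΩ, h1, map_mul, inner_conj_symm] at h2
    exact Complex.conj_eq_iff_re.1 (mul_right_cancel₀ (inner_self_ne_zero.2 (b.ne_zero i)) h2).symm
  refine ⟨fun j β => -(Complex.I * β) * l (σ j) (Complex.I * (β : ℂ)⁻¹),
    fun j β => e (σ j) (Complex.I * (β : ℂ)⁻¹), fun j => (deriv (l (σ j)) 0).re, ?_, ?_, ?_, ?_,
    ?_, ?_⟩
  · filter_upwards [tendsto_I_mul_inv.eventually h, eventually_gt_atTop 0] with β hβ hβ0 j
    have hβ' : (β : ℂ) ≠ 0 := Complex.ofReal_ne_zero.2 hβ0.ne'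
    have h1 := congrArg (fun x => (-(Complex.I * (β : ℂ))) • x) (hβ (σ j))
    simp only [add_apply, FunLike.coe_smul, Pi.smul_apply, smul_add, smul_smul] at h1
    rw [← h1]
    have : -(Complex.I * (β : ℂ)) * (Complex.I * (β : ℂ)⁻¹) = 1 := by
      calc _ = -(Complex.I * Complex.I) * ((β : ℂ) * (β : ℂ)⁻¹) := by ring
        _ = 1 := by rw [Complex.I_mul_I, mul_inv_cancel₀ hβ']; norm_num
    rw [this, one_smul, neg_smul]
    abel
  · have hcont : ContinuousAt (fun z : ℂ => fun i => e i z) 0 :=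
      continuousAt_pi.2 fun i => (he i).continuousAt
    have hli : LinearIndependent ℂ (fun i => e i 0) := by
      simp only [heb]; exact b.linearIndependent
    have hev : ∀ᶠ z in 𝓝 (0 : ℂ), LinearIndependent ℂ (fun i => e i z) :=
      hcont.eventually (isOpen_setOfPred_linearIndependent.mem_nhds hli)
    filter_upwards [tendsto_I_mul_inv.eventually hev] with β hβ
    exact hβ.comp σ σ.injective
  · exact fun j => ⟨_, (he (σ j)).comp_I_mul, Eventually.of_forall fun β => rfl⟩
  · exact fun j hj => hasPoleAtInfinity_of_ne_zero (hl _) fun h0 => not_le.2 hj ((hσ j).2 h0)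
  · intro j hj
    have h0 := (hσ j).1 hj
    rw [hreal _ h0]
    exact analyticAtInfinity_of_eq_zero (hl _) h0
  · rw [← card_zero_eigenvalues_compression b hBb hfirst]
    refine Fintype.card_congr (σ.subtypeEquiv fun j => ?_)
    rw [hσ j]
    refine and_congr_right fun h0 => ?_
    rw [← hreal _ h0, Complex.ofReal_eq_zero]

end Modes

/-! ### Comparing the limits of two families -/

section Limits

theorem eventually_norm_lt_iff_of_tendsto {f : ℝ → ℂ} {c : ℂ} (h : Tendsto f atTop (𝓝 c)) :
    ∀ᶠ ρ : ℝ in 𝓝[>] 0, ∀ᶠ β in atTop, (‖f β‖ < ρ ↔ c = 0) := by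
  by_cases hc : c = 0
  · filter_upwards [self_mem_nhdsWithin] with ρ hρ
    have h1 : Tendsto (fun β => ‖f β‖) atTop (𝓝 0) := by simpa [hc] using h.norm
    filter_upwards [h1.eventually (gt_mem_nhds hρ)] with β hβ
    exact iff_of_true hβ hc
  · filter_upwards [nhdsWithin_le_nhds (gt_mem_nhds (norm_pos_iff.2 hc))] with ρ hρ
    filter_upwards [h.norm.eventually (lt_mem_nhds hρ)] with β hβ
    exact iff_of_false (not_lt.2 hβ.le) hc

/-- If two families of functions have eventually the same values with multiplicities, then they
have the same number of members that tend to zero. -/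
theorem card_tendsto_zero_eq {n r : ℕ} {ζ ζ' : Fin n → ℝ → ℂ} {c c' : Fin n → ℂ}
    (heq : ∀ᶠ β in atTop, Finset.univ.val.map (fun j => ζ j β) =
      Finset.univ.val.map fun j => ζ' j β)
    (hhigh : ∀ j : Fin n, (j : ℕ) < r → Tendsto (fun β => ‖ζ j β‖) atTop atTop)
    (hhigh' : ∀ j : Fin n, (j : ℕ) < r → Tendsto (fun β => ‖ζ' j β‖) atTop atTop)
    (hlow : ∀ j : Fin n, r ≤ (j : ℕ) → Tendsto (ζ j) atTop (𝓝 (c j)))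
    (hlow' : ∀ j : Fin n, r ≤ (j : ℕ) → Tendsto (ζ' j) atTop (𝓝 (c' j)))
    [DecidablePred fun j : Fin n => r ≤ (j : ℕ) ∧ c j = 0]
    [DecidablePred fun j : Fin n => r ≤ (j : ℕ) ∧ c' j = 0] :
    Fintype.card {j : Fin n // r ≤ (j : ℕ) ∧ c j = 0} =
      Fintype.card {j : Fin n // r ≤ (j : ℕ) ∧ c' j = 0} := by
  have key : ∀ {ξ : Fin n → ℝ → ℂ} {d : Fin n → ℂ},
      (∀ j : Fin n, (j : ℕ) < r → Tendsto (fun β => ‖ξ j β‖) atTop atTop) →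
      (∀ j : Fin n, r ≤ (j : ℕ) → Tendsto (ξ j) atTop (𝓝 (d j))) →
      ∀ᶠ ρ : ℝ in 𝓝[>] 0, ∀ᶠ β in atTop, ∀ j, (‖ξ j β‖ < ρ ↔ r ≤ (j : ℕ) ∧ d j = 0) := by
    intro ξ d h1 h2
    have : ∀ j, ∀ᶠ ρ : ℝ in 𝓝[>] 0, ∀ᶠ β in atTop, (‖ξ j β‖ < ρ ↔ r ≤ (j : ℕ) ∧ d j = 0) := by
      intro j
      rcases lt_or_ge (j : ℕ) r with hj | hj
      · refine Eventually.of_forall fun ρ => ?_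
        filter_upwards [(h1 j hj).eventually (eventually_ge_atTop ρ)] with β hβ
        exact iff_of_false (not_lt.2 hβ) fun h => not_le.2 hj h.1
      · filter_upwards [eventually_norm_lt_iff_of_tendsto (h2 j hj)] with ρ hρ
        filter_upwards [hρ] with β hβ
        rw [hβ]
        exact ⟨fun h => ⟨hj, h⟩, fun h => h.2⟩
    filter_upwards [eventually_all.2 this] with ρ hρ
    exact eventually_all.2 hρ
  -- One radius and one `β` serve both families: the values in the disc of radius `ρ` are exactly
  -- those of the members tending to zero, and the two multisets coincide.
  obtain ⟨ρ, h1, h2⟩ := ((key hhigh hlow).and (key hhigh' hlow')).exists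
  obtain ⟨β, h3, h4, h5⟩ := (h1.and (h2.and heq)).exists
  classical
  have h6 := congrArg (Multiset.countP fun x => ‖x‖ < ρ) h5
  rw [Multiset.countP_map, Multiset.countP_map] at h6
  rw [Fintype.card_subtype, Fintype.card_subtype]
  calc _ = (Finset.univ.filter fun j => ‖ζ j β‖ < ρ).card := by
        congr 1; ext j; simp [h3 j]
    _ = (Finset.univ.filter fun j => ‖ζ' j β‖ < ρ).card := h6
    _ = _ := by congr 1; ext j; simp [h4 j]

/-- By finiteness a single `k` matches `f` for arbitrarily large `β`. It cannot blow up, as `f`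
stays bounded, so its limit is that of `f`. -/
theorem exists_limit_eq_of_eventually_mem {n r : ℕ} {f : ℝ → ℂ} {ζ' : Fin n → ℝ → ℂ} {c : ℂ}
    {c' : Fin n → ℂ} (h : ∀ᶠ β in atTop, ∃ k, ζ' k β = f β) (hf : Tendsto f atTop (𝓝 c))
    (hhigh' : ∀ j : Fin n, (j : ℕ) < r → Tendsto (fun β => ‖ζ' j β‖) atTop atTop)
    (hlow' : ∀ j : Fin n, r ≤ (j : ℕ) → Tendsto (ζ' j) atTop (𝓝 (c' j))) : ∃ k, c = c' k := by
  obtain ⟨k, hk⟩ : ∃ k, ∃ᶠ β in atTop, ζ' k β = f β := by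
    by_contra hc
    push Not at hc
    obtain ⟨β, ⟨k, h1⟩, h2⟩ := (h.and (eventually_all.2 hc)).exists
    exact h2 k h1
  rcases lt_or_ge (k : ℕ) r with hj | hj
  · exfalso
    obtain ⟨β, h1, h2, h3⟩ := (hk.and_eventually
      (((hhigh' k hj).eventually (eventually_ge_atTop (‖c‖ + 1))).and
        (hf.norm.eventually (gt_mem_nhds (lt_add_one ‖c‖))))).exists
    rw [h1] at h2
    exact not_lt.2 h2 h3
  · refine ⟨k, ?_⟩
    have h1 : Tendsto (fun β => f β - ζ' k β) atTop (𝓝 (c - c' k)) := hf.sub (hlow' k hj)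
    have h2 : c - c' k ∈ ({0} : Set ℂ) := isClosed_singleton.mem_of_frequently_of_tendsto
      (hk.mono fun β hβ => by simp [hβ]) h1
    exact sub_eq_zero.1 h2

theorem card_fin_Ico {n r : ℕ} (h : 2 * r ≤ n) :
    Fintype.card {j : Fin n // r ≤ (j : ℕ) ∧ (j : ℕ) < 2 * r} = r := by
  conv_rhs => rw [← Fintype.card_fin r]
  exact Fintype.card_congr
    { toFun := fun j => ⟨j.1 - r, by have := j.2; omega⟩
      invFun := fun i => ⟨⟨r + i, by omega⟩, by simp, by simp; omega⟩
      left_inv := fun j => by ext; have := j.2; simp; omega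
      right_inv := fun i => by ext; simp }

/-- A permutation of the indices `≥ r` that moves the zeros of `c`, assumed to be `r` in number,
to the first places. -/
theorem exists_perm_zeros_first {n r : ℕ} {c : Fin n → ℝ}
    [DecidablePred fun j : Fin n => r ≤ (j : ℕ) ∧ c j = 0]
    (h : Fintype.card {j : Fin n // r ≤ (j : ℕ) ∧ c j = 0} = r) (h2 : 2 * r ≤ n) :
    ∃ σ : Equiv.Perm (Fin n), (∀ j : Fin n, (j : ℕ) < r → σ j = j) ∧
      ∀ j : Fin n, r ≤ (j : ℕ) → r ≤ (σ j : ℕ) ∧ ((j : ℕ) < 2 * r ↔ c (σ j) = 0) := by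
  classical
  obtain ⟨τ, hτ⟩ := exists_equiv_iff (α := {j : Fin n // r ≤ (j : ℕ)})
    (γ := {j : Fin n // r ≤ (j : ℕ)}) (fun x => (x.1 : ℕ) < 2 * r) (fun y => c y.1 = 0) rfl (by
      rw [Fintype.card_congr (Equiv.subtypeSubtypeEquivSubtypeInter (fun j : Fin n => r ≤ (j : ℕ))
        fun j => (j : ℕ) < 2 * r), Fintype.card_congr
        (Equiv.subtypeSubtypeEquivSubtypeInter (fun j : Fin n => r ≤ (j : ℕ)) fun j => c j = 0),
        card_fin_Ico h2]
      exact h.symm.trans (Fintype.card_congr (Equiv.refl _)))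
  refine ⟨Equiv.Perm.ofSubtype (p := fun j : Fin n => r ≤ (j : ℕ)) τ, fun j hj => ?_,
    fun j hj => ?_⟩
  · exact Equiv.Perm.ofSubtype_apply_of_not_mem τ (not_le.2 hj)
  · rw [Equiv.Perm.ofSubtype_apply_of_mem (p := fun j : Fin n => r ≤ (j : ℕ)) τ hj]
    exact ⟨(τ ⟨j, hj⟩).2, hτ ⟨j, hj⟩⟩

theorem tendsto_ofReal_inv_atTop : Tendsto (fun β : ℝ => (β : ℂ)⁻¹) atTop (𝓝 0) :=
  (tendsto_ofReal_zero.comp tendsto_inv_atTop_zero).congr fun β => by simp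

theorem HasPoleAtInfinity.tendsto_norm {ζ : ℝ → ℂ} (h : HasPoleAtInfinity ζ) :
    Tendsto (fun β => ‖ζ β‖) atTop atTop := by
  obtain ⟨g, -, ho, h⟩ := h
  have h1 : Tendsto (fun β : ℝ => (β : ℂ)⁻¹) atTop (𝓝[≠] 0) := by
    refine tendsto_nhdsWithin_iff.2 ⟨tendsto_ofReal_inv_atTop, ?_⟩
    filter_upwards [eventually_gt_atTop 0] with β hβ
    exact inv_ne_zero (Complex.ofReal_ne_zero.2 hβ.ne')
  have h2 := tendsto_norm_cobounded_atTop.comp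
    ((tendsto_cobounded_of_meromorphicOrderAt_neg ho).comp h1)
  exact h2.congr' (h.mono fun β hβ => by simp [hβ])

theorem AnalyticAtInfinity.exists_tendsto {ζ : ℝ → ℂ} (h : AnalyticAtInfinity ζ) :
    ∃ c, Tendsto ζ atTop (𝓝 c) := by
  obtain ⟨g, hg, h⟩ := h
  exact ⟨g 0, (hg.continuousAt.tendsto.comp tendsto_ofReal_inv_atTop).congr'
    (h.mono fun β hβ => by simp [hβ])⟩

/-- The germ vanishes at `0` and is differentiable there. -/
theorem AnalyticAtInfinity.norm_le_div {ζ : ℝ → ℂ} (h : AnalyticAtInfinity ζ)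
    (h0 : Tendsto ζ atTop (𝓝 0)) : ∃ C : ℝ, 0 ≤ C ∧ ∀ᶠ β in atTop, ‖ζ β‖ ≤ C / β := by
  obtain ⟨g, hg, h⟩ := h
  have hg0 : g 0 = 0 := tendsto_nhds_unique
    ((hg.continuousAt.tendsto.comp tendsto_ofReal_inv_atTop).congr'
      (h.mono fun β hβ => by simp [hβ])) h0
  obtain ⟨C, hC, hb⟩ := hg.differentiableAt.isBigO_sub.exists_nonneg
  refine ⟨C, hC, ?_⟩
  filter_upwards [h, tendsto_ofReal_inv_atTop.eventually hb.bound, eventually_gt_atTop 0] with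
    β h1 h2 h3
  rw [hg0, sub_zero, sub_zero, ← h1, norm_inv, Complex.norm_real, Real.norm_of_nonneg h3.le] at h2
  rwa [div_eq_mul_inv]

theorem tendsto_qFactor_zero {ζ : ℝ → ℂ} (him : ∀ᶠ β in atTop, (ζ β).im ≤ 0)
    (h : ∀ ε : ℝ, 0 < ε → ∀ᶠ β in atTop,
      ζ β = 0 ∨ (ζ β).im ≠ 0 ∧ |(ζ β).re| ≤ 2 * ε * -(ζ β).im) :
    Tendsto (fun β => qFactor (ζ β)) atTop (𝓝 0) := by
  rw [ENNReal.tendsto_nhds_zero]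
  intro ε hε
  obtain ⟨δ, hδ, hδε⟩ := ENNReal.lt_iff_exists_nnreal_btwn.1 hε
  filter_upwards [him, h δ (by exact_mod_cast hδ)] with β h1 h2
  refine (qFactor_le_of_im_neg h2 h1).trans ?_
  rw [ENNReal.ofReal_coe_nnreal]
  exact hδε.le

theorem analyticAt_withLp_prod {E : Type*} [NormedAddCommGroup E] [NormedSpace ℂ E]
    {g : ℂ → WithLp 2 (E × E)} (hg : AnalyticAt ℂ g 0) :
    AnalyticAt ℂ (fun z => (g z).fst) 0 ∧ AnalyticAt ℂ (fun z => (g z).snd) 0 := by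
  have h := ((WithLp.prodContinuousLinearEquiv 2 ℂ E E).toContinuousLinearMap.analyticAt
    (g 0)).fun_comp hg
  exact ⟨((ContinuousLinearMap.fst ℂ E E).analyticAt _).fun_comp h,
    ((ContinuousLinearMap.snd ℂ E E).analyticAt _).fun_comp h⟩

end Limits

/-! ### Families of modes of the Lagrangian system -/

namespace LagrangianSystem

variable {N : ℕ} (S : LagrangianSystem N)

/-- The dissipation operator on `ℂ^N ⊕ ℂ^N`. -/
noncomputable abbrev dissOp := lossOp (S.lossRoot.adjoint ∘L S.lossRoot)

/-- The frequency operator on `ℂ^N ⊕ ℂ^N`. -/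
noncomputable abbrev frequencyOp := freqOp S.gyro S.stiff

theorem dissOp_symm (u v) : inner ℂ (S.dissOp u) v = inner ℂ u (S.dissOp v) :=
  lossOp_symm (fun x y => by
    simp [ContinuousLinearMap.adjoint_inner_left, ContinuousLinearMap.adjoint_inner_right]) u v

theorem dissOp_nonneg (u) :
    0 ≤ (inner ℂ u (S.dissOp u)).re ∧ (inner ℂ u (S.dissOp u)).im = 0 := by
  have : inner ℂ u (S.dissOp u) = ((‖S.lossRoot u.fst‖ ^ 2 : ℝ) : ℂ) := by
    simp [WithLp.prod_inner_apply, ContinuousLinearMap.adjoint_inner_right,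
      inner_self_eq_norm_sq_to_K]
  rw [this]
  exact ⟨by rw [Complex.ofReal_re]; positivity, Complex.ofReal_im _⟩

theorem frequencyOp_symm (u v) : inner ℂ (S.frequencyOp u) v = inner ℂ u (S.frequencyOp v) :=
  freqOp_symm S.inner_gyro u v

theorem finrank_split :
    Module.finrank ℂ (WithLp 2 (EuclideanSpace ℂ (Fin N) × EuclideanSpace ℂ (Fin N))) = 2 * N := by
  rw [← (splitEquiv N).finrank_eq]
  simp [two_mul]

variable {S}

theorem eigen_iff {β : ℝ} {ζ : ℂ} {w : Fin N ⊕ Fin N → ℂ} :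
    (S.A β).mulVec w = ζ • w ↔ S.frequencyOp (splitEquiv N w) -
      (Complex.I * β) • S.dissOp (splitEquiv N w) = ζ • splitEquiv N w := by
  rw [← splitEquiv_mulVec, ← map_smul, (splitEquiv N).injective.eq_iff]

namespace IsModeFamily

variable {ζ ζ' : Fin (2 * N) → ℝ → ℂ} {w w' : Fin (2 * N) → ℝ → (Fin N ⊕ Fin N → ℂ)}

theorem eventually_split (h : S.IsModeFamily ζ w) : ∀ᶠ β : ℝ in atTop, ∀ j,
    splitEquiv N (w j β) ≠ 0 ∧ S.frequencyOp (splitEquiv N (w j β)) -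
      (Complex.I * β) • S.dissOp (splitEquiv N (w j β)) = ζ j β • splitEquiv N (w j β) := by
  filter_upwards [h.eigen, h.basis] with β h1 h2 j
  exact ⟨(splitEquiv N).map_ne_zero_iff.2 (h2.ne_zero j), eigen_iff.1 (h1 j)⟩

theorem im_nonpos (h : S.IsModeFamily ζ w) (j : Fin (2 * N)) : ∀ᶠ β : ℝ in atTop,
    (ζ j β).im ≤ 0 ∧ |(ζ j β).re| ≤ ‖S.frequencyOp‖ := by
  filter_upwards [h.eventually_split, eventually_ge_atTop 0] with β h1 h2
  exact im_nonpos_of_dissipative S.dissOp_nonneg S.frequencyOp_symm h2 (h1 j).1 (h1 j).2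

theorem map_eq_roots (h : S.IsModeFamily ζ w) : ∀ᶠ β : ℝ in atTop,
    Finset.univ.val.map (fun j => ζ j β) = (S.A β).mulVecLin.charpoly.roots := by
  filter_upwards [h.eigen, h.basis] with β h1 h2
  -- The positive rank excludes `N = 0`; the basis construction needs a nonempty index type.
  rcases N.eq_zero_or_pos with hN | hN
  · subst hN
    have := S.rank_pos
    have h3 := S.R.rank_le_card_width
    simp at h3
    omega
  have : Nonempty (Fin (2 * N)) := ⟨⟨0, by omega⟩⟩
  let b := basisOfLinearIndependentOfCardEqFinrank h2 (by simp [two_mul])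
  exact map_eigenvalues_eq_roots_charpoly b fun j => by simpa [b] using h1 j

theorem exists_eq_pow_mul (h : S.IsModeFamily ζ w) (j : Fin (2 * N)) :
    ∃ (n : ℕ) (g : ℂ → ℂ), AnalyticAt ℂ g 0 ∧
      ∀ᶠ β : ℝ in atTop, ζ j β = (β : ℂ) ^ n * g (β : ℂ)⁻¹ := by
  rcases lt_or_ge (j : ℕ) S.lossRank with hj | hj
  · exact (h.high_loss j hj).exists_eq_pow_mul
  · exact (h.low_loss j hj).exists_eq_pow_mul

theorem decreasesToZero (h : S.IsModeFamily ζ w) {j : Fin (2 * N)}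
    (hQ : Tendsto (fun β => qFactor (ζ j β)) atTop (𝓝 0)) :
    DecreasesToZero fun β => qFactor (ζ j β) := by
  obtain ⟨n, g, hg, hζ⟩ := h.exists_eq_pow_mul j
  obtain ⟨b, hb⟩ := qFactor_eventually_constant_or_strict hg n hζ ((h.im_nonpos j).mono
    fun β hβ => hβ.1)
  exact decreasesToZero_of_tendsto hb hQ

theorem increasesToTop (h : S.IsModeFamily ζ w) {j : Fin (2 * N)}
    (hQ : Tendsto (fun β => qFactor (ζ j β)) atTop (𝓝 ⊤)) :
    IncreasesToTop fun β => qFactor (ζ j β) := by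
  obtain ⟨n, g, hg, hζ⟩ := h.exists_eq_pow_mul j
  obtain ⟨b, hb⟩ := qFactor_eventually_constant_or_strict hg n hζ ((h.im_nonpos j).mono
    fun β hβ => hβ.1)
  exact increasesToTop_of_tendsto hb hQ

theorem decreasesToZero_of_high_loss (h : S.IsModeFamily ζ w) {j : Fin (2 * N)}
    (hj : (j : ℕ) < S.lossRank) : DecreasesToZero fun β => qFactor (ζ j β) := by
  refine h.decreasesToZero (tendsto_qFactor_zero ((h.im_nonpos j).mono fun β hβ => hβ.1)
    fun ε hε => ?_)
  -- As `|Re ζ| ≤ ‖Ω‖`, this threshold leaves `-Im ζ ≥ ‖Ω‖/(2ε) + 1`; the summand `1` keeps it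
  -- nonzero even if `Ω = 0`.
  filter_upwards [h.im_nonpos j, (h.high_loss j hj).tendsto_norm.eventually
    (eventually_ge_atTop (‖S.frequencyOp‖ + ‖S.frequencyOp‖ / (2 * ε) + 1))] with β h1 h2
  have h3 := Complex.norm_le_abs_re_add_abs_im (ζ j β)
  rw [abs_of_nonpos h1.1] at h3
  have h4 : ‖S.frequencyOp‖ / (2 * ε) + 1 ≤ -(ζ j β).im := by linarith [h1.2]
  have h5 : 0 ≤ ‖S.frequencyOp‖ / (2 * ε) := by positivity
  refine Or.inr ⟨fun h0 => by rw [h0] at h4; linarith, h1.2.trans ?_⟩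
  have h6 := mul_le_mul_of_nonneg_left h4 (by positivity : 0 ≤ 2 * ε)
  rw [mul_add, mul_div_cancel₀ _ (by positivity : 2 * ε ≠ 0)] at h6
  linarith

theorem decreasesToZero_of_tendsto_zero (h : S.IsModeFamily ζ w)
    (hker : LinearMap.ker S.R.mulVecLin ⊓ LinearMap.ker S.η.mulVecLin = ⊥) {j : Fin (2 * N)}
    (hj : S.lossRank ≤ (j : ℕ)) (h0 : Tendsto (ζ j) atTop (𝓝 0)) :
    DecreasesToZero fun β => qFactor (ζ j β) := by
  obtain ⟨C₀, hC₀, hb⟩ := (h.low_loss j hj).norm_le_div h0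
  obtain ⟨C, hC⟩ := exists_overdamped_bound S.inner_gyro (S.eq_zero_of_loss_of_stiff hker) hC₀
  refine h.decreasesToZero (tendsto_qFactor_zero ((h.im_nonpos j).mono fun β hβ => hβ.1)
    fun ε hε => ?_)
  have h1 : Tendsto (fun β : ℝ => C / β) atTop (𝓝 0) := tendsto_const_nhds.div_atTop tendsto_id
  filter_upwards [hb, hC, h.eventually_split, h.im_nonpos j, h1.eventually (gt_mem_nhds hε)] with
    β h2 h3 h4 h5 h6
  refine (h3 _ _ (h4 j).1 (h4 j).2 h2).imp_right fun h7 => ⟨h7.1, h7.2.trans ?_⟩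
  have : 0 ≤ -(ζ j β).im := neg_nonneg.2 h5.1
  gcongr

end IsModeFamily

/-- Existence of a family of modes whose low-loss eigenvalues have known limits. -/
theorem exists_isModeFamily (S : LagrangianSystem N) :
    ∃ (ζ : Fin (2 * N) → ℝ → ℂ) (w : Fin (2 * N) → ℝ → (Fin N ⊕ Fin N → ℂ))
      (a : Fin (2 * N) → ℝ), S.IsModeFamily ζ w ∧
      (∀ j : Fin (2 * N), S.lossRank ≤ (j : ℕ) → Tendsto (ζ j) atTop (𝓝 ((a j : ℝ) : ℂ))) ∧
      Fintype.card {j : Fin (2 * N) // S.lossRank ≤ (j : ℕ) ∧ a j = 0} =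
        Module.finrank ℂ (compressionKernel S.dissOp S.frequencyOp) := by
  obtain ⟨ζ, u, a, h1, h2, h3, h4, h5, h6⟩ := exists_modes S.dissOp_symm S.frequencyOp_symm
    (finrank_split (N := N)) ((finrank_range_lossOp _).trans S.finrank_range_lossRoot)
  refine ⟨ζ, fun j β => (splitEquiv N).symm (u j β), a, ⟨?_, ?_, ?_, h4, fun j hj => (h5 j hj).1⟩,
    fun j hj => (h5 j hj).2, h6⟩
  · filter_upwards [h1] with β hβ j
    rw [eigen_iff, LinearEquiv.apply_symm_apply]
    exact hβ j
  · filter_upwards [h2] with β hβ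
    exact hβ.map' (splitEquiv N).symm.toLinearMap (splitEquiv N).symm.ker
  · intro j
    obtain ⟨g, hg, hgu⟩ := h3 j
    refine ⟨fun z => (splitEquiv N).symm (g z), ?_,
      hgu.mono fun β hβ => congrArg (splitEquiv N).symm hβ⟩
    rw [analyticAt_pi_iff]
    rintro (i | i)
    · exact ((EuclideanSpace.proj (𝕜 := ℂ) i).analyticAt _).fun_comp (analyticAt_withLp_prod hg).1
    · exact ((EuclideanSpace.proj (𝕜 := ℂ) i).analyticAt _).fun_comp (analyticAt_withLp_prod hg).2

/-- The given family is compared with the constructed one: equal spectra for large `β` force its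
low-loss limits to be real and exactly `N_R` of them to vanish. -/
theorem IsModeFamily.exists_perm {S : LagrangianSystem N} {ζ : Fin (2 * N) → ℝ → ℂ}
    {w : Fin (2 * N) → ℝ → (Fin N ⊕ Fin N → ℂ)} (h : S.IsModeFamily ζ w)
    (hker : LinearMap.ker S.R.mulVecLin ⊓ LinearMap.ker S.η.mulVecLin = ⊥) :
    ∃ σ : Equiv.Perm (Fin (2 * N)), (∀ j : Fin (2 * N), (j : ℕ) < S.lossRank → σ j = j) ∧
      S.IsIndexedByLimits (fun j => ζ (σ j)) := by
  classical
  obtain ⟨ζ', w', a, h', hlim, hcard⟩ := S.exists_isModeFamily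
  rw [finrank_compressionKernel (S.eq_zero_of_loss_of_stiff hker), S.finrank_range_lossRoot]
    at hcard
  have heq : ∀ᶠ β in atTop, Finset.univ.val.map (fun j => ζ j β) =
      Finset.univ.val.map fun j => ζ' j β := by
    filter_upwards [h.map_eq_roots, h'.map_eq_roots] with β h1 h2
    rw [h1, h2]
  have hlow : ∀ j : Fin (2 * N), ∃ c : ℝ, S.lossRank ≤ (j : ℕ) →
      Tendsto (ζ j) atTop (𝓝 (c : ℂ)) := by
    intro j
    rcases lt_or_ge (j : ℕ) S.lossRank with hj | hj
    -- The value `0` at high-loss indices is a dummy; the count below only concerns indices `≥ N_R`.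
    · exact ⟨0, fun h => absurd h (not_le.2 hj)⟩
    obtain ⟨c, hc⟩ := (h.low_loss j hj).exists_tendsto
    obtain ⟨k, rfl⟩ := exists_limit_eq_of_eventually_mem (ζ' := ζ') (c' := fun k => (a k : ℂ))
      (heq.mono fun β hβ => by
        have : ζ j β ∈ Finset.univ.val.map fun j => ζ' j β := by
          rw [← hβ]; exact Multiset.mem_map_of_mem _ (Finset.mem_univ j)
        obtain ⟨k, -, hk⟩ := Multiset.mem_map.1 this
        exact ⟨k, hk⟩) hc (fun k hk => (h'.high_loss k hk).tendsto_norm) hlim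
    exact ⟨a k, fun _ => hc⟩
  choose c hc using hlow
  have hcard' := card_tendsto_zero_eq (c := fun j => (c j : ℂ)) (c' := fun j => (a j : ℂ)) heq
    (fun k hk => (h.high_loss k hk).tendsto_norm) (fun k hk => (h'.high_loss k hk).tendsto_norm)
    hc hlim
  simp only [Complex.ofReal_eq_zero] at hcard'
  have hr : S.lossRank ≤ N := S.R.rank_le_width
  obtain ⟨σ, hσ, hσ'⟩ := exists_perm_zeros_first (c := c) (hcard'.trans hcard) (by omega)
  refine ⟨σ, hσ, fun j hj hj2 => ?_, fun j hj => ?_⟩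
  · have h1 := hc (σ j) (hσ' j hj).1
    rwa [((hσ' j hj).2).1 hj2, Complex.ofReal_zero] at h1
  · have hj' : S.lossRank ≤ (j : ℕ) := by omega
    exact ⟨c (σ j), fun h0 => by have := ((hσ' j hj').2).2 h0; omega, hc _ (hσ' j hj').1⟩

end LagrangianSystem

theorem mainTheorem6 {N : ℕ} (S : LagrangianSystem N) :
    -- the eigenpairs of the high-loss regime exist
    (∃ (ζ : Fin (2 * N) → ℝ → ℂ) (w : Fin (2 * N) → ℝ → (Fin N ⊕ Fin N → ℂ)),
      S.IsModeFamily ζ w) ∧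
    -- high-loss modes
    (∀ (ζ : Fin (2 * N) → ℝ → ℂ) (w : Fin (2 * N) → ℝ → (Fin N ⊕ Fin N → ℂ)),
      S.IsModeFamily ζ w →
      ∀ j : Fin (2 * N), (j : ℕ) < S.lossRank → DecreasesToZero (fun β => qFactor (ζ j β))) ∧
    -- low-loss modes
    (LinearMap.ker S.R.mulVecLin ⊓ LinearMap.ker S.η.mulVecLin = ⊥ →
      -- the low-loss modes can be reindexed according to their limits
      (∀ (ζ : Fin (2 * N) → ℝ → ℂ) (w : Fin (2 * N) → ℝ → (Fin N ⊕ Fin N → ℂ)),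
        S.IsModeFamily ζ w →
        ∃ σ : Equiv.Perm (Fin (2 * N)), (∀ j : Fin (2 * N), (j : ℕ) < S.lossRank → σ j = j) ∧
          S.IsIndexedByLimits (fun j => ζ (σ j))) ∧
      -- and, once so indexed, are of low Q and of high Q respectively
      (∀ (ζ : Fin (2 * N) → ℝ → ℂ) (w : Fin (2 * N) → ℝ → (Fin N ⊕ Fin N → ℂ)),
        S.IsModeFamily ζ w → S.IsIndexedByLimits ζ →
        (∀ j : Fin (2 * N), S.lossRank ≤ (j : ℕ) → (j : ℕ) < 2 * S.lossRank →
          DecreasesToZero (fun β => qFactor (ζ j β))) ∧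
        (∀ j : Fin (2 * N), 2 * S.lossRank ≤ (j : ℕ) →
          IncreasesToTop (fun β => qFactor (ζ j β))))) := by
  refine ⟨?_, fun ζ w h j hj => h.decreasesToZero_of_high_loss hj, fun hker =>
    ⟨fun ζ w h => h.exists_perm hker, fun ζ w h hi => ⟨fun j hj hj2 =>
      h.decreasesToZero_of_tendsto_zero hker hj (hi.1 j hj hj2), fun j hj => ?_⟩⟩⟩
  · obtain ⟨ζ, w, -, h, -⟩ := S.exists_isModeFamily
    exact ⟨ζ, w, h⟩
  · obtain ⟨ρ, hρ, hlim⟩ := hi.2 j hj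
    exact h.increasesToTop
      (tendsto_qFactor_top hρ ((h.im_nonpos j).mono fun β hβ => hβ.1) hlim)
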